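/- Let $c>0$ and $b>0$. For $t\in\mathbb R$ and $\mathbf R=(x,y,z)\in\mathbb R^3$ put $\rho^2=x^2+y^2$, $$S=\sqrt{(ct+ib)^2-\rho^2},\qquad \theta=S-z-ib,$$ where the branch of the root is the one with $S=ct+ib$ for $\rho=0$ (equivalently $\operatorname{Im}S>0$); then $\operatorname{Im}\theta\ge 0$. For a function $f$ on the closed upper half-plane consider the quasi-spherical wave $u(t,\mathbf R)=f(\theta)/S$. Let $H$ be the Heaviside step function, $H(p)=1$ for $p>0$ and $H(p)=0$ for $p\le 0$. For a unit vector $\mathbf N$ let $\cos\mathcal X$ be its $z$-component, and let $d^2\mathbf N$ be the surface element of the unit sphere. (1) Suppose that $f$ is continuously complex-differentiable on the closed upper half-plane (hence analytic in the open one) and $f(\theta)=O(1/|\theta|)$ as $|\theta|\to\infty$ there. Then for every $s\in\mathbb R$ and every unit vector $\mathbf n$ with $z$-component $\cos\chi\ne 0$, $$\lim_{t\to+\infty} ct\,u\bigl(t,(ct+s)\mathbf n\bigr)=F(s,\mathbf n):=\frac{H(\cos\chi)}{\cos\chi}\,f\!\left(\frac{-s+ib(1-\cos\chi)}{\cos\chi}\right).$$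 Put $F(s,\mathbf n)=0$ for $\cos\chi=0$, and let $F'=\partial F/\partial s$. Then for all $t$ and $\mathbf R$, with absolutely convergent integrals over the unit sphere and over the forward hemisphere $\Sigma_+=\{|\mathbf N|=1,\ \cos\mathcal X>0\}$, $$u(t,\mathbf R)=\frac1{2\pi}\iint_{|\mathbf N|=1}F'(\mathbf N\cdot\mathbf R-ct,\mathbf N)\,d^2\mathbf N =-\frac1{2\pi}\iint_{\Sigma_+}\frac{1}{\cos^2\mathcal X}\,f'\!\left(\frac{ct-\mathbf N\cdot\mathbf R+ib(1-\cos\mathcal X)}{\cos\mathcal X}\right)d^2\mathbf N$$ $$=-\frac1{2\pi}\int_{-\pi}^{\pi}d\phi\int_0^{\pi/2}\frac{\sin\mathcal X\,d\mathcal X}{\cos^2\mathcal X}\,f'\!\left(\frac{(ct+ib)-(z+ib)\cos\mathcal X-(x\cos\phi+y\sin\phi)\sin\mathcal X}{\cos\mathcal X}\right).$$ (2) Suppose that $f(\theta)=\int_0^\infty\hat f(\kappa)e^{i\kappa\theta}\,d\kappa$ for all $\theta$ with $\operatorname{Im}\theta\ge0$, where $\hat f\in L^1(0,\infty)$. Then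 for all $t$ and $\mathbf R$, with $k=\sqrt{k_x^2+k_y^2+k_z^2}$, $$u(t,\mathbf R)=-\frac{i}{2\pi}\int_0^\infty\hat f(k_z)\,dk_z\int_{-\infty}^\infty dk_x\int_{-\infty}^\infty dk_y\,\frac{e^{i[k(ct+ib)-k_z(z+ib)-k_xx-k_yy]}}{k} =-\frac{i}{2\pi}\iiint_{\mathbb R^3}H(k_z)\hat f(k_z)\,\frac{e^{i[k(ct+ib)-k_z(z+ib)-k_xx-k_yy]}}{k}\,d^3\mathbf k,$$ where the last integral converges absolutely. -/

import Mathlib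

open MeasureTheory Set Filter Topology

noncomputable section

/-- Euclidean three-space; the coordinates `x, y, z` are the components `0, 1, 2`. -/
abbrev Space3 : Type := EuclideanSpace ℝ (Fin 3)

/-- `ρ² = x² + y²`. -/
def rhoSq (R : Space3) : ℝ := (R 0) ^ 2 + (R 1) ^ 2

/-- `S = √((ct + ib)² - ρ²)`, the branch that equals `ct + ib` on the axis `ρ = 0`.
For `b > 0` this is the square root with positive imaginary part; see `quasiS_sq`,
`quasiS_axis`, `quasiS_continuous` and `le_quasiS_im` below. -/
def quasiS (c b t : ℝ) (R : Space3) : ℂ :=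
  Complex.I * (((rhoSq R : ℝ) : ℂ) - ((c * t : ℝ) + Complex.I * (b : ℝ)) ^ 2) ^ (1 / 2 : ℂ)

/-- The quasi-spherical phase `θ = S - z - ib`. -/
def quasiPhase (c b t : ℝ) (R : Space3) : ℂ :=
  quasiS c b t R - (R 2 : ℝ) - Complex.I * (b : ℝ)

/-- The quasi-spherical wave `u = f(θ) / S`. -/
def quasiWave (f : ℂ → ℂ) (c b t : ℝ) (R : Space3) : ℂ :=
  f (quasiPhase c b t R) / quasiS c b t R

/-- The closed upper half-plane, which is the range of values of the phase. -/
def closedUpperHalf : Set ℂ := {θ | 0 ≤ θ.im}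

/-- Waveforms: continuously complex-differentiable on the closed upper half-plane
(hence holomorphic on the open one), and decreasing no slower than `1/|θ|` at infinity. -/
structure IsWaveform (f : ℂ → ℂ) : Prop where
  contDiffOn : ContDiffOn ℂ 1 f closedUpperHalf
  decay : f =O[Bornology.cobounded ℂ ⊓ 𝓟 closedUpperHalf] fun θ : ℂ => ‖θ‖⁻¹

/-- The Heaviside step function (its value at `0` is immaterial). -/
def heavisideStep (p : ℝ) : ℂ := if 0 < p then 1 else 0

/-- The far-field amplitude
`F(s, n) = H(cos χ) / cos χ * f((-s + ib(1 - cos χ)) / cos χ)`, with `cos χ = n · k` the third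
component of `n`. -/
def farField (f : ℂ → ℂ) (b s : ℝ) (n : Space3) : ℂ :=
  heavisideStep (n 2) / (n 2 : ℝ) *
    f ((-(s : ℂ) + Complex.I * (b : ℝ) * (1 - (n 2 : ℝ))) / (n 2 : ℝ))

/-- The surface measure of the unit sphere (of total mass `4π`). -/
def surfaceMeasure : Measure (Metric.sphere (0 : Space3) 1) := (volume : Measure Space3).toSphere

/-- The monochromatic plane wave `exp(i[k(ct+ib) - k_z(z+ib) - k_x x - k_y y]) / k` with wave
vector `K = (k_x, k_y, k_z)` and `k = |K|`. -/
def planeWave (c b t : ℝ) (R K : Space3) : ℂ :=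
  Complex.exp (Complex.I *
    (((‖K‖ : ℝ) : ℂ) * ((c * t : ℝ) + Complex.I * (b : ℝ))
      - (K 2 : ℝ) * ((R 2 : ℝ) + Complex.I * (b : ℝ))
      - (K 0 : ℝ) * (R 0 : ℝ) - (K 1 : ℝ) * (R 1 : ℝ))) / (‖K‖ : ℝ)

lemma rhoSq_nonneg (R : Space3) : 0 ≤ rhoSq R := by unfold rhoSq; positivity

lemma quasiS_sq (c b t : ℝ) (R : Space3) :
    quasiS c b t R ^ 2 = ((c * t : ℝ) + Complex.I * (b : ℝ)) ^ 2 - ((rhoSq R : ℝ) : ℂ) := by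
  unfold quasiS
  rw [mul_pow, Complex.I_sq, one_div]
  have := Complex.cpow_nat_inv_pow
    (((rhoSq R : ℝ) : ℂ) - ((c * t : ℝ) + Complex.I * (b : ℝ)) ^ 2) (n := 2) two_ne_zero
  rw [Nat.cast_ofNat] at this
  rw [this]
  ring

lemma quasiS_radicand_mem (c b t : ℝ) (hb : 0 < b) (R : Space3) :
    ((rhoSq R : ℝ) : ℂ) - ((c * t : ℝ) + Complex.I * (b : ℝ)) ^ 2 ∈ Complex.slitPlane := by
  rw [Complex.mem_slitPlane_iff]
  have h := rhoSq_nonneg R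
  by_cases ht : c * t = 0
  · left
    simp [ht, sq]
    nlinarith
  · right
    simp [sq]
    intro h
    have h2 : 2 * (b * (c * t)) = 0 := by linarith
    have : b * (c * t) ≠ 0 := mul_ne_zero hb.ne' ht
    apply this
    linarith

lemma quasiS_im_pos (c b t : ℝ) (hb : 0 < b) (R : Space3) : 0 < (quasiS c b t R).im := by
  unfold quasiS
  have h := quasiS_radicand_mem c b t hb R
  set w := ((rhoSq R : ℝ) : ℂ) - ((c * t : ℝ) + Complex.I * (b : ℝ)) ^ 2
  rw [Complex.I_mul_im, Complex.cpow_def_of_ne_zero (Complex.slitPlane_ne_zero h), Complex.exp_re]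
  apply mul_pos (Real.exp_pos _)
  have e : (Complex.log w * (1 / 2)).im = w.arg / 2 := by
    rw [show (1 / 2 : ℂ) = ((1 / 2 : ℝ) : ℂ) by norm_num, Complex.im_mul_ofReal, Complex.log_im]
    ring
  rw [e]
  have h1 := Complex.neg_pi_lt_arg w
  have h2 := Complex.arg_le_pi w
  have h3 := (Complex.mem_slitPlane_iff_arg.mp h).1
  have h4 : w.arg < Real.pi := lt_of_le_of_ne h2 h3
  apply Real.cos_pos_of_mem_Ioo
  constructor <;> linarith

/-- On the axis, `S = ct + ib`. -/
lemma quasiS_axis (c b t : ℝ) (hb : 0 < b) (R : Space3) (hR : rhoSq R = 0) :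
    quasiS c b t R = (c * t : ℝ) + Complex.I * (b : ℝ) := by
  have h := quasiS_sq c b t R
  rw [hR, Complex.ofReal_zero, sub_zero] at h
  rcases sq_eq_sq_iff_eq_or_eq_neg.mp h with h | h
  · exact h
  · have h1 := quasiS_im_pos c b t hb R
    rw [h] at h1
    simp at h1
    linarith

lemma quasiS_continuous (c b : ℝ) (hb : 0 < b) :
    Continuous fun p : ℝ × Space3 => quasiS c b p.1 p.2 := by
  unfold quasiS
  refine continuous_const.mul (Continuous.cpow ?_ continuous_const ?_)
  · unfold rhoSq
    fun_prop
  · intro p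
    exact quasiS_radicand_mem c b p.1 hb p.2

lemma le_quasiS_im (c b t : ℝ) (hb : 0 < b) (R : Space3) : b ≤ (quasiS c b t R).im := by
  have h := quasiS_sq c b t R
  have hq := quasiS_im_pos c b t hb R
  have hr := rhoSq_nonneg R
  have h1 := congrArg Complex.re h
  have h2 := congrArg Complex.im h
  set p := (quasiS c b t R).re with hp
  set q := (quasiS c b t R).im with hqd
  simp [sq, ← hp, ← hqd] at h1 h2
  by_contra! hlt
  have h3 : p * q = c * t * b := by linarith
  have h5 : (c * t) ^ 2 * q ^ 2 ≤ p ^ 2 * q ^ 2 := by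
    rw [← mul_pow p q, h3, mul_pow (c * t) b]
    exact mul_le_mul_of_nonneg_left (pow_le_pow_left₀ hq.le hlt.le 2) (sq_nonneg _)
  have h6 : (c * t) ^ 2 ≤ p ^ 2 := le_of_mul_le_mul_right h5 (by positivity)
  nlinarith

/-- The phase takes its values in the closed upper half-plane. -/
lemma quasiPhase_mem (c b t : ℝ) (hb : 0 < b) (R : Space3) :
    quasiPhase c b t R ∈ closedUpperHalf := by
  have := le_quasiS_im c b t hb R
  simp [closedUpperHalf, quasiPhase]
  linarith

end

/-! Project the forward hemisphere from its centre onto the plane z = 1. In the resulting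
coordinates P = (p, q), with w = √(1 + p² + q²), one has cos 𝒳 = 1/w and surface element w⁻³ dp dq
(`surfaceMeasure_restrict_forward`). Hence d²N / cos² 𝒳 becomes dp dq / w, the Lorentz-invariant
measure on the mass shell, and the argument of f' becomes T w - x p - y q - Z with T = ct + ib and Z
= z + ib. Both parts rest on one identity, `IsProfile.integral_shell`: the integral of f'(T w - x p
- y q - Z) dp dq / w equals -2π f(S - Z) / S, where S² = T² - x² - y².

For real T this would be a boost of (T, x, y) to (S, 0, 0) by change of variables. Since T is
complex, the boost is not a real substitution. Instead (T, x) is moved along a path on which τ² - ξ²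
is constant; the parameter derivative of the integrand is then a total derivative in p and
integrates to zero (`hasDerivAt_boost_integral`). Once x and y are boosted away, polar coordinates
leave the exact derivative of f(S w - Z) / S (`IsProfile.integral_radial`).

The identity needs only ‖f θ‖ ≤ C / Im θ and an f' that is bounded on bounded sets (`IsProfile`), so
it covers waveforms and also the exponentials e^{iκθ}. Rescaled by κ, the exponential case evaluates
the slice k_z = κ in the second part. The modulus of a plane wave is the plane wave at t = 0, R = 0,
so each slice has absolute integral 2π/b whatever κ is, and integrability of the spectrum justifies
Fubini.

The far-field limit is a separate asymptotic computation along a ray, where S / ct tends to |cos χ|.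
-/

/-! ### The square root on the upper half-plane -/

/-- The square root with values in the closed upper half-plane, cut along `[0, ∞)`. -/
noncomputable def upRoot (z : ℂ) : ℂ := Complex.I * (-z) ^ (1 / 2 : ℂ)

lemma upRoot_sq (z : ℂ) : upRoot z ^ 2 = z := by
  unfold upRoot
  rw [mul_pow, Complex.I_sq, one_div]
  have := Complex.cpow_nat_inv_pow (-z) (n := 2) two_ne_zero
  rw [Nat.cast_ofNat] at this
  rw [this]
  ring

lemma upRoot_im_pos {z : ℂ} (h : -z ∈ Complex.slitPlane) : 0 < (upRoot z).im := by
  unfold upRoot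
  rw [Complex.I_mul_im, Complex.cpow_def_of_ne_zero (Complex.slitPlane_ne_zero h), Complex.exp_re]
  apply mul_pos (Real.exp_pos _)
  have e : (Complex.log (-z) * (1 / 2)).im = (-z).arg / 2 := by
    rw [show (1 / 2 : ℂ) = ((1 / 2 : ℝ) : ℂ) by norm_num, Complex.im_mul_ofReal, Complex.log_im]
    ring
  rw [e]
  have h1 := Complex.neg_pi_lt_arg (-z)
  have h4 : (-z).arg < Real.pi :=
    lt_of_le_of_ne (Complex.arg_le_pi (-z)) (Complex.mem_slitPlane_iff_arg.mp h).1
  apply Real.cos_pos_of_mem_Ioo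
  constructor <;> linarith

lemma neg_sq_sub_mem_slitPlane {T : ℂ} (hT : 0 < T.im) {r : ℝ} (hr : 0 ≤ r) :
    -(T ^ 2 - r) ∈ Complex.slitPlane := by
  rw [Complex.mem_slitPlane_iff]
  simp only [neg_sub, Complex.sub_re, Complex.ofReal_re, sq, Complex.mul_re, Complex.sub_im,
    Complex.ofReal_im, Complex.mul_im]
  by_cases h : T.re = 0
  · left
    rw [h]
    nlinarith
  · right
    have : T.re * T.im ≠ 0 := mul_ne_zero h hT.ne'
    intro h'
    apply this
    linarith

lemma eq_upRoot_of_sq_eq {z w : ℂ} (hw : 0 < w.im) (h : w ^ 2 = z)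
    (hz : -z ∈ Complex.slitPlane) : upRoot z = w := by
  have h1 := upRoot_im_pos hz
  rcases sq_eq_sq_iff_eq_or_eq_neg.mp ((upRoot_sq z).trans h.symm) with h2 | h2
  · exact h2
  · rw [h2, Complex.neg_im] at h1
    linarith

/-- Write the root as p + iq. Then pq = Re T · Im T, so q < Im T would force p² ≥ (Re T)² and make
p² - q² exceed (Re T)² - (Im T)², against r ≥ 0. Consequently the bound b ≤ Im T survives every
boost. -/
lemma im_le_upRoot_im {T : ℂ} (hT : 0 < T.im) {r : ℝ} (hr : 0 ≤ r) :
    T.im ≤ (upRoot (T ^ 2 - r)).im := by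
  have h := upRoot_sq (T ^ 2 - r)
  have hq := upRoot_im_pos (neg_sq_sub_mem_slitPlane hT hr)
  generalize upRoot (T ^ 2 - r) = w at h hq ⊢
  have h1 := congrArg Complex.re h
  have h2 := congrArg Complex.im h
  simp only [sq, Complex.mul_re, Complex.mul_im, Complex.sub_re, Complex.sub_im,
    Complex.ofReal_re, Complex.ofReal_im] at h1 h2
  set p := w.re
  set q := w.im
  by_contra! hlt
  have h3 : p * q = T.re * T.im := by linarith
  have h5 : T.re ^ 2 * q ^ 2 ≤ p ^ 2 * q ^ 2 := by
    rw [← mul_pow p q, h3, mul_pow]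
    exact mul_le_mul_of_nonneg_left (pow_le_pow_left₀ hq.le hlt.le 2) (sq_nonneg _)
  have h6 : T.re ^ 2 ≤ p ^ 2 := le_of_mul_le_mul_right h5 (by positivity)
  nlinarith

lemma upRoot_sq_sub_im_pos {T : ℂ} (hT : 0 < T.im) {r : ℝ} (hr : 0 ≤ r) :
    0 < (upRoot (T ^ 2 - r)).im := hT.trans_le (im_le_upRoot_im hT hr)

lemma upRoot_sq_sub_ne_zero {T : ℂ} (hT : 0 < T.im) {r : ℝ} (hr : 0 ≤ r) :
    upRoot (T ^ 2 - r) ≠ 0 := by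
  intro h
  have := upRoot_sq_sub_im_pos hT hr
  simp [h] at this

/-- Boosting away x and then y has the same effect as boosting away both at once. -/
lemma upRoot_sq_sub_sub (T : ℂ) (r s : ℝ) :
    upRoot (upRoot (T ^ 2 - r) ^ 2 - s) = upRoot (T ^ 2 - (r + s : ℝ)) := by
  rw [upRoot_sq]
  push_cast
  rw [sub_sub]

lemma upRoot_sq_eq_self {T : ℂ} (hT : 0 < T.im) : upRoot (T ^ 2) = T :=
  eq_upRoot_of_sq_eq hT rfl (by simpa using neg_sq_sub_mem_slitPlane hT le_rfl)

lemma HasDerivAt.upRoot {γ : ℝ → ℂ} {γ' : ℂ} {s : ℝ} (h : HasDerivAt γ γ' s)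
    (hs : -γ s ∈ Complex.slitPlane) :
    HasDerivAt (fun s => upRoot (γ s)) (γ' / (2 * upRoot (γ s))) s := by
  have h1 : HasDerivAt (fun z : ℂ => z ^ (1 / 2 : ℂ)) ((1 / 2) * (-γ s) ^ ((1 / 2 : ℂ) - 1) * 1)
      (-γ s) := (hasDerivAt_id (-γ s)).cpow_const hs
  have h2 := (h1.comp_of_eq s h.neg rfl).const_mul Complex.I
  have h0 := Complex.slitPlane_ne_zero hs
  have hne : (-γ s) ^ (1 / 2 : ℂ) ≠ 0 := by
    rw [Complex.cpow_ne_zero_iff_of_exponent_ne_zero (by norm_num)]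
    exact h0
  have e : (-γ s) ^ ((1 / 2 : ℂ) - 1) = ((-γ s) ^ (1 / 2 : ℂ))⁻¹ := by
    rw [show (1 / 2 : ℂ) - 1 = -(1 / 2) by norm_num, Complex.cpow_neg]
  refine h2.congr_deriv ?_
  rw [e, _root_.upRoot]
  field_simp
  rw [Complex.I_sq]
  ring

lemma quasiS_eq_upRoot (c b t : ℝ) (R : Space3) :
    quasiS c b t R = upRoot (((c * t : ℝ) + Complex.I * (b : ℝ)) ^ 2 - ((rhoSq R : ℝ) : ℂ)) := by
  rw [quasiS, upRoot, neg_sub]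

/-! ### Cauchy estimates and boost invariance in one variable -/

/-- The open upper half-plane. -/
abbrev openUpperHalf : Set ℂ := {θ | 0 < θ.im}

lemma isOpen_openUpperHalf : IsOpen openUpperHalf :=
  isOpen_lt continuous_const Complex.continuous_im

lemma nonneg_of_norm_le_div_im_pow {f : ℂ → ℂ} {C : ℝ} {n : ℕ}
    (hC : ∀ θ ∈ openUpperHalf, ‖f θ‖ ≤ C / θ.im ^ n) : 0 ≤ C := by
  simpa using (norm_nonneg _).trans (hC Complex.I (by simp [openUpperHalf]))

/-- Cauchy's estimate on the disc of radius Im θ / 2, where imaginary parts stay above Im θ / 2. The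
halved height costs 2ⁿ and the radius one more factor 2. -/
lemma norm_deriv_le_of_norm_le_div_im_pow {f : ℂ → ℂ} {C : ℝ} {n : ℕ}
    (hf : DifferentiableOn ℂ f openUpperHalf) (hC : ∀ θ ∈ openUpperHalf, ‖f θ‖ ≤ C / θ.im ^ n)
    {θ : ℂ} (hθ : θ ∈ openUpperHalf) : ‖deriv f θ‖ ≤ (2 ^ (n + 1) * C) / θ.im ^ (n + 1) := by
  have hy : 0 < θ.im := hθ
  have hC0 := nonneg_of_norm_le_div_im_pow hC
  have him : ∀ z ∈ Metric.closedBall θ (θ.im / 2), θ.im / 2 ≤ z.im := by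
    intro z hz
    have h1 := (Complex.abs_im_le_norm (z - θ)).trans (mem_closedBall_iff_norm.mp hz)
    rw [Complex.sub_im, abs_le] at h1
    linarith
  have hsub : Metric.closedBall θ (θ.im / 2) ⊆ openUpperHalf := fun z hz =>
    lt_of_lt_of_le (half_pos hy) (him z hz)
  have key := Complex.norm_deriv_le_of_forall_mem_sphere_norm_le (c := θ) (R := θ.im / 2)
    (C := C / (θ.im / 2) ^ n) (f := f) (half_pos hy) (by
      refine DifferentiableOn.diffContOnCl ?_
      rw [closure_ball _ (half_pos hy).ne']
      exact hf.mono hsub) (by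
      intro z hz
      have hz' := Metric.sphere_subset_closedBall hz
      refine (hC z (hsub hz')).trans ?_
      have := him z hz'
      gcongr)
  refine key.trans (le_of_eq ?_)
  rw [div_pow, pow_succ, pow_succ]
  field_simp

lemma hasDerivAt_sqrt_add_sq {a : ℝ} (ha : 0 < a) (p : ℝ) :
    HasDerivAt (fun p : ℝ => √(a + p ^ 2)) (p / √(a + p ^ 2)) p := by
  have h := ((hasDerivAt_pow 2 p).const_add a).sqrt (by positivity)
  refine h.congr_deriv ?_
  have : √(a + p ^ 2) ≠ 0 := by positivity
  field_simp
  simp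

/-- The imaginary part is Im T · w - b with w = √(a + p²), and b ≤ b w / √a. Strictness of a > 1
keeps the phase away from the real axis and makes its height grow like w. -/
lemma boost_im_lower_bound {a b : ℝ} (ha : 1 < a) (hb : 0 < b) {T Z : ℂ} (hT : b ≤ T.im)
    (hZ : Z.im = b) (y p : ℝ) :
    b * (1 - 1 / √a) * √(a + p ^ 2) ≤ (T * (√(a + p ^ 2) : ℝ) - (y : ℝ) * (p : ℝ) - Z).im := by
  have h1 : (T * (√(a + p ^ 2) : ℝ) - (y : ℝ) * (p : ℝ) - Z).im = T.im * √(a + p ^ 2) - b := by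
    simp [hZ]
  rw [h1]
  have h2 : √a ≤ √(a + p ^ 2) := Real.sqrt_le_sqrt (by nlinarith)
  have h3 : 0 < √a := by positivity
  have h4 : 1 ≤ 1 / √a * √(a + p ^ 2) := by
    rw [one_div, inv_mul_eq_div, le_div_iff₀ h3]
    linarith
  have h5 : b * √(a + p ^ 2) ≤ T.im * √(a + p ^ 2) := by gcongr
  nlinarith

lemma one_sub_one_div_sqrt_pos {a : ℝ} (ha : 1 < a) : 0 < 1 - 1 / √a := by
  have : 1 < √a := by rw [Real.lt_sqrt] <;> linarith
  rw [sub_pos, div_lt_one] <;> linarith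

section boost

variable {h : ℂ → ℂ} {C a b : ℝ} {T Z : ℂ}

lemma boost_mem (ha : 1 < a) (hb : 0 < b) (hT : b ≤ T.im) (hZ : Z.im = b) (y p : ℝ) :
    T * (√(a + p ^ 2) : ℝ) - (y : ℝ) * (p : ℝ) - Z ∈ openUpperHalf := by
  have h1 := boost_im_lower_bound ha hb hT hZ y p
  have h2 := one_sub_one_div_sqrt_pos ha
  have : 0 < √(a + p ^ 2) := by positivity
  exact lt_of_lt_of_le (by positivity) h1

lemma boost_norm_le {n : ℕ} (hC : ∀ θ ∈ openUpperHalf, ‖h θ‖ ≤ C / θ.im ^ n)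
    (ha : 1 < a) (hb : 0 < b) (hT : b ≤ T.im) (hZ : Z.im = b) (y p : ℝ) :
    ‖h (T * (√(a + p ^ 2) : ℝ) - (y : ℝ) * (p : ℝ) - Z)‖
      ≤ C / (b * (1 - 1 / √a)) ^ n / √(a + p ^ 2) ^ n := by
  have hm := boost_mem ha hb hT hZ y p
  have h1 := boost_im_lower_bound ha hb hT hZ y p
  have h2 := one_sub_one_div_sqrt_pos ha
  have h3 : 0 < √(a + p ^ 2) := by positivity
  have hC0 := nonneg_of_norm_le_div_im_pow hC
  refine (hC _ hm).trans ?_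
  rw [div_div, ← mul_pow]
  gcongr

lemma one_div_sqrt_sq_le (ha : 1 < a) (p : ℝ) : 1 / √(a + p ^ 2) ^ 2 ≤ (1 + p ^ 2)⁻¹ := by
  rw [Real.sq_sqrt (by positivity), one_div]
  gcongr

lemma one_le_sqrt_add_sq (ha : 1 < a) (p : ℝ) : 1 ≤ √(a + p ^ 2) := by
  rw [Real.one_le_sqrt]
  nlinarith

lemma one_div_sqrt_cube_le (ha : 1 < a) (p : ℝ) : 1 / √(a + p ^ 2) ^ 3 ≤ (1 + p ^ 2)⁻¹ := by
  refine le_trans ?_ (one_div_sqrt_sq_le ha p)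
  have := one_le_sqrt_add_sq ha p
  gcongr
  · simp

lemma continuous_comp_boost {g : ℂ → ℂ} (hg : ContinuousOn g openUpperHalf)
    (ha : 1 < a) (hb : 0 < b) (hT : b ≤ T.im) (hZ : Z.im = b) (y : ℝ) :
    Continuous fun p : ℝ => g (T * (√(a + p ^ 2) : ℝ) - (y : ℝ) * (p : ℝ) - Z) :=
  hg.comp_continuous (by fun_prop) fun p => boost_mem ha hb hT hZ y p

lemma sqrt_add_sq_ofReal_ne_zero (ha : 1 < a) (p : ℝ) : ((√(a + p ^ 2) : ℝ) : ℂ) ≠ 0 := by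
  have : 0 < √(a + p ^ 2) := by positivity
  exact_mod_cast this.ne'

lemma continuous_boost_integrand (hh : DifferentiableOn ℂ h openUpperHalf)
    (ha : 1 < a) (hb : 0 < b) (hT : b ≤ T.im) (hZ : Z.im = b) (y : ℝ) :
    Continuous fun p : ℝ =>
      h (T * (√(a + p ^ 2) : ℝ) - (y : ℝ) * (p : ℝ) - Z) / (√(a + p ^ 2) : ℝ) :=
  (continuous_comp_boost hh.continuousOn ha hb hT hZ y).div (by fun_prop)
    (sqrt_add_sq_ofReal_ne_zero ha)

lemma integrable_comp_boost (hh : DifferentiableOn ℂ h openUpperHalf)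
    (hC : ∀ θ ∈ openUpperHalf, ‖h θ‖ ≤ C / θ.im ^ 2)
    (ha : 1 < a) (hb : 0 < b) (hT : b ≤ T.im) (hZ : Z.im = b) (y : ℝ) :
    Integrable fun p : ℝ => h (T * (√(a + p ^ 2) : ℝ) - (y : ℝ) * (p : ℝ) - Z) := by
  refine (integrable_inv_one_add_sq.const_mul (C / (b * (1 - 1 / √a)) ^ 2)).mono'
    (continuous_comp_boost hh.continuousOn ha hb hT hZ y).aestronglyMeasurable
    (Eventually.of_forall fun p => (boost_norm_le hC ha hb hT hZ y p).trans ?_)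
  have hC0 := nonneg_of_norm_le_div_im_pow hC
  have h0 : 0 ≤ C / (b * (1 - 1 / √a)) ^ 2 := by positivity
  rw [div_eq_mul_one_div]
  exact mul_le_mul_of_nonneg_left (one_div_sqrt_sq_le ha p) h0

lemma integrable_boost_integrand (hh : DifferentiableOn ℂ h openUpperHalf)
    (hC : ∀ θ ∈ openUpperHalf, ‖h θ‖ ≤ C / θ.im ^ 2)
    (ha : 1 < a) (hb : 0 < b) (hT : b ≤ T.im) (hZ : Z.im = b) (y : ℝ) :
    Integrable fun p : ℝ =>
      h (T * (√(a + p ^ 2) : ℝ) - (y : ℝ) * (p : ℝ) - Z) / (√(a + p ^ 2) : ℝ) := by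
  refine (integrable_comp_boost hh hC ha hb hT hZ y).mono
    (continuous_boost_integrand hh ha hb hT hZ y).aestronglyMeasurable
    (Eventually.of_forall fun p => ?_)
  rw [norm_div, Complex.norm_real, Real.norm_of_nonneg (by positivity)]
  exact div_le_self (norm_nonneg _) (one_le_sqrt_add_sq ha p)

/-- Along the family of boosts `s ↦ (√(T² - x² cos² s), x sin s)` the integral over the mass shell
does not change. -/
lemma hasDerivAt_boost_integral (hh : DifferentiableOn ℂ h openUpperHalf)
    (hC : ∀ θ ∈ openUpperHalf, ‖h θ‖ ≤ C / θ.im ^ 2)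
    (ha : 1 < a) (hb : 0 < b) (hT : b ≤ T.im) (hZ : Z.im = b) (x s₀ : ℝ) :
    HasDerivAt (fun s : ℝ => ∫ p : ℝ,
      h (upRoot (T ^ 2 - ((x * Real.cos s) ^ 2 : ℝ)) * (√(a + p ^ 2) : ℝ)
        - ((x * Real.sin s : ℝ) : ℂ) * (p : ℝ) - Z) / (√(a + p ^ 2) : ℝ)) 0 s₀ := by
  have hT0 : 0 < T.im := hb.trans_le hT
  set τ : ℝ → ℂ := fun s => upRoot (T ^ 2 - ((x * Real.cos s) ^ 2 : ℝ)) with hτ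
  have hτim : ∀ s, b ≤ (τ s).im := fun s => hT.trans (im_le_upRoot_im hT0 (sq_nonneg _))
  have hτ0 : ∀ s, τ s ≠ 0 := fun s => upRoot_sq_sub_ne_zero hT0 (sq_nonneg _)
  have hτn : ∀ s, b ≤ ‖τ s‖ := fun s =>
    (hτim s).trans ((le_abs_self _).trans (Complex.abs_im_le_norm _))
  -- Along the path τ² - (x sin s)² stays equal to T² - x², which is what makes it a family of
  -- boosts.
  have hτd : ∀ s, HasDerivAt τ (x ^ 2 * Real.cos s * Real.sin s / τ s) s := by
    intro s
    have h1 : HasDerivAt (fun s : ℝ => T ^ 2 - (((x * Real.cos s) ^ 2 : ℝ) : ℂ))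
        (2 * (x ^ 2 * Real.cos s * Real.sin s : ℝ)) s := by
      have := ((((Real.hasDerivAt_cos s).const_mul x).fun_pow 2).ofReal_comp).const_sub (T ^ 2)
      refine this.congr_deriv ?_
      push_cast
      ring
    refine (h1.upRoot (neg_sq_sub_mem_slitPlane hT0 (sq_nonneg _))).congr_deriv ?_
    have := hτ0 s
    change _ / (2 * τ s) = _
    field_simp
    push_cast
    ring
  set dh := deriv h
  have hdh : ∀ θ ∈ openUpperHalf, ‖dh θ‖ ≤ (2 ^ 3 * C) / θ.im ^ 3 := fun θ hθ =>
    norm_deriv_le_of_norm_le_div_im_pow hh hC hθ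
  have hdhc : ContinuousOn dh openUpperHalf := (hh.deriv isOpen_openUpperHalf).continuousOn
  have hder : ∀ θ ∈ openUpperHalf, HasDerivAt h (dh θ) θ := fun θ hθ =>
    (hh.differentiableAt (isOpen_openUpperHalf.mem_nhds hθ)).hasDerivAt
  set arg : ℝ → ℝ → ℂ := fun s p =>
    τ s * (√(a + p ^ 2) : ℝ) - ((x * Real.sin s : ℝ) : ℂ) * (p : ℝ) - Z with harg
  have hmem : ∀ s p, arg s p ∈ openUpperHalf := fun s p => boost_mem ha hb (hτim s) hZ _ p
  have hw : ∀ p : ℝ, ((√(a + p ^ 2) : ℝ) : ℂ) ≠ 0 := sqrt_add_sq_ofReal_ne_zero ha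
  set D : ℝ → ℝ → ℂ := fun s p => x ^ 2 * Real.cos s * Real.sin s / τ s * (√(a + p ^ 2) : ℝ)
    - x * Real.cos s * p with hD
  have hargs : ∀ s p, HasDerivAt (fun s => arg s p) (D s p) s := by
    intro s p
    have h2 := (((Real.hasDerivAt_sin s).const_mul x).ofReal_comp).mul_const (p : ℂ)
    refine ((((hτd s).mul_const _).sub h2).sub_const Z).congr_deriv ?_
    simp only [hD]
    push_cast
    rfl
  have hDle : ∀ s p, ‖D s p‖ ≤ (x ^ 2 / b + |x|) * √(a + p ^ 2) := by
    intro s p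
    have hp : |p| ≤ √(a + p ^ 2) := Real.abs_le_sqrt (by linarith)
    have hc := Real.abs_cos_le_one s
    have hs := Real.abs_sin_le_one s
    have e1 : ‖(x : ℂ) ^ 2 * Real.cos s * Real.sin s / τ s‖ ≤ x ^ 2 / b := by
      rw [norm_div, norm_mul, norm_mul, norm_pow, Complex.norm_real, Complex.norm_real,
        Complex.norm_real, Real.norm_eq_abs, Real.norm_eq_abs, Real.norm_eq_abs, sq_abs]
      refine div_le_div₀ (sq_nonneg x) ?_ hb (hτn s)
      calc x ^ 2 * |Real.cos s| * |Real.sin s| ≤ x ^ 2 * 1 * 1 := by gcongr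
        _ = x ^ 2 := by ring
    have e2 : ‖(x : ℂ) * Real.cos s * p‖ ≤ |x| * √(a + p ^ 2) := by
      rw [norm_mul, norm_mul, Complex.norm_real, Complex.norm_real,
        Complex.norm_real, Real.norm_eq_abs, Real.norm_eq_abs, Real.norm_eq_abs]
      calc |x| * |Real.cos s| * |p| ≤ |x| * 1 * √(a + p ^ 2) := by gcongr
        _ = _ := by ring
    refine (norm_sub_le _ _).trans ?_
    rw [norm_mul, Complex.norm_real, Real.norm_of_nonneg (by positivity), add_mul]
    gcongr
  have hF' : ∀ s p, HasDerivAt (fun s => h (arg s p) / (√(a + p ^ 2) : ℝ))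
      (dh (arg s p) * D s p / (√(a + p ^ 2) : ℝ)) s := fun s p =>
    ((hder _ (hmem s p)).comp s (hargs s p)).div_const _
  have hdarg : ∀ s, Continuous fun p => dh (arg s p) := fun s =>
    continuous_comp_boost hdhc ha hb (hτim s) hZ _
  have hF'c : ∀ s, Continuous fun p : ℝ => dh (arg s p) * D s p / (√(a + p ^ 2) : ℝ) := fun s =>
    ((hdarg s).mul (by fun_prop)).div (by fun_prop) hw
  set K := 2 ^ 3 * C / (b * (1 - 1 / √a)) ^ 3 with hK
  have hdle : ∀ s p, ‖dh (arg s p)‖ ≤ K / √(a + p ^ 2) ^ 3 := fun s p =>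
    boost_norm_le hdh ha hb (hτim s) hZ _ p
  have hC0 := nonneg_of_norm_le_div_im_pow hC
  have h3 := one_sub_one_div_sqrt_pos ha
  have hK0 : 0 ≤ K := by positivity
  -- The phase velocity `D` grows at most like w, `dh` decays like w⁻³ and the measure gives w⁻¹: a
  -- dominating function independent of s.
  have hbound : ∀ s p, ‖dh (arg s p) * D s p / (√(a + p ^ 2) : ℝ)‖
      ≤ K * (x ^ 2 / b + |x|) * (1 + p ^ 2)⁻¹ := by
    intro s p
    have hw0 : 0 < √(a + p ^ 2) := by positivity
    rw [norm_div, norm_mul, Complex.norm_real, Real.norm_of_nonneg hw0.le]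
    calc _ ≤ K / √(a + p ^ 2) ^ 3 * ((x ^ 2 / b + |x|) * √(a + p ^ 2)) / √(a + p ^ 2) := by
          gcongr
          exacts [hdle s p, hDle s p]
      _ = K * (x ^ 2 / b + |x|) * (1 / √(a + p ^ 2) ^ 3) := by field_simp
      _ ≤ _ := by
          gcongr
          exact one_div_sqrt_cube_le ha p
  have main := (hasDerivAt_integral_of_dominated_loc_of_deriv_le (μ := volume)
    (F := fun s p => h (arg s p) / (√(a + p ^ 2) : ℝ))
    (F' := fun s p => dh (arg s p) * D s p / (√(a + p ^ 2) : ℝ)) (x₀ := s₀)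
    (bound := fun p => K * (x ^ 2 / b + |x|) * (1 + p ^ 2)⁻¹) (s := univ) univ_mem
    (Eventually.of_forall fun s =>
      (continuous_boost_integrand hh ha hb (hτim s) hZ _).aestronglyMeasurable)
    (integrable_boost_integrand hh hC ha hb (hτim s₀) hZ _)
    (hF'c s₀).aestronglyMeasurable
    (Eventually.of_forall fun p s _ => hbound s p)
    (integrable_inv_one_add_sq.const_mul _)
    (Eventually.of_forall fun p s _ => hF' s p)).2
  refine main.congr_deriv ?_
  -- the derivative of the integrand in the parameter is a total derivative in `p`
  have hp : ∀ p : ℝ, HasDerivAt (fun p => h (arg s₀ p))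
      (dh (arg s₀ p) * (τ s₀ * (p / √(a + p ^ 2) : ℝ) - (x * Real.sin s₀ : ℝ))) p := by
    intro p
    refine (hder _ (hmem s₀ p)).comp p ?_
    have h1 := ((hasDerivAt_sqrt_add_sq (by linarith : 0 < a) p).ofReal_comp).const_mul (τ s₀)
    have h2 := ((hasDerivAt_id p).ofReal_comp).const_mul ((x * Real.sin s₀ : ℝ) : ℂ)
    refine ((h1.sub h2).sub_const Z).congr_deriv ?_
    simp
  have hrel : ∀ p : ℝ, dh (arg s₀ p) * D s₀ p / (√(a + p ^ 2) : ℝ) =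
      -(x * Real.cos s₀ / τ s₀) *
        (dh (arg s₀ p) * (τ s₀ * (p / √(a + p ^ 2) : ℝ) - (x * Real.sin s₀ : ℝ))) := by
    intro p
    have h1 := hτ0 s₀
    have h2 := hw p
    simp only [hD]
    push_cast
    field_simp
    ring
  -- If the factor vanishes, so does the integrand. Otherwise it can be divided out, which transfers
  -- integrability to the p-derivative.
  by_cases hz : (x * Real.cos s₀ / τ s₀ : ℂ) = 0
  · simp_rw [hrel, hz]
    simp
  have hint : Integrable fun p : ℝ => dh (arg s₀ p) * D s₀ p / (√(a + p ^ 2) : ℝ) :=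
    (integrable_inv_one_add_sq.const_mul _).mono' (hF'c s₀).aestronglyMeasurable
      (Eventually.of_forall (hbound s₀))
  simp_rw [hrel] at hint ⊢
  rw [integral_const_mul, integral_eq_zero_of_hasDerivAt_of_integrable hp
    ((integrable_const_mul_iff (IsUnit.mk0 _ (neg_ne_zero.mpr hz)) _).mp hint)
    (integrable_comp_boost hh hC ha hb (hτim s₀) hZ _), mul_zero]

/-- The integral is constant along the path: s = π/2 is the point (T, x), and s = 0 is the point
where x has been boosted away. -/
lemma integral_boost (hh : DifferentiableOn ℂ h openUpperHalf)
    (hC : ∀ θ ∈ openUpperHalf, ‖h θ‖ ≤ C / θ.im ^ 2)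
    (ha : 1 < a) (hb : 0 < b) (hT : b ≤ T.im) (hZ : Z.im = b) (x : ℝ) :
    ∫ p : ℝ, h (T * (√(a + p ^ 2) : ℝ) - (x : ℂ) * (p : ℝ) - Z) / (√(a + p ^ 2) : ℝ) =
      ∫ p : ℝ, h (upRoot (T ^ 2 - (x ^ 2 : ℝ)) * (√(a + p ^ 2) : ℝ) - Z) / (√(a + p ^ 2) : ℝ) := by
  have hd := hasDerivAt_boost_integral hh hC ha hb hT hZ x
  have hc := is_const_of_deriv_eq_zero (fun s => (hd s).differentiableAt) (fun s => (hd s).deriv)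
    (Real.pi / 2) 0
  simp only [Real.cos_pi_div_two, Real.sin_pi_div_two, Real.cos_zero, Real.sin_zero, mul_zero,
    mul_one, Complex.ofReal_zero, zero_mul, sub_zero, zero_pow two_ne_zero] at hc
  rwa [upRoot_sq_eq_self (hb.trans_le hT)] at hc

end boost

/-! ### The integral over the two-dimensional mass shell -/

/-- The height `√(1 + p² + q²)` of the unit mass shell over the point `(p, q)`. -/
noncomputable def shell (P : ℝ × ℝ) : ℝ := √(1 + P.1 ^ 2 + P.2 ^ 2)

lemma one_le_shell (P : ℝ × ℝ) : 1 ≤ shell P := by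
  rw [shell, Real.one_le_sqrt]
  nlinarith [sq_nonneg P.1, sq_nonneg P.2]

lemma shell_pos (P : ℝ × ℝ) : 0 < shell P := one_pos.trans_le (one_le_shell P)

lemma shell_ne_zero (P : ℝ × ℝ) : (shell P : ℂ) ≠ 0 := by exact_mod_cast (shell_pos P).ne'

lemma one_lt_shell {P : ℝ × ℝ} (hP : P ≠ 0) : 1 < shell P := by
  rw [shell, Real.lt_sqrt zero_le_one]
  have : P.1 ≠ 0 ∨ P.2 ≠ 0 := by
    by_contra! h
    exact hP (Prod.ext h.1 h.2)
  rcases this with h | h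
  · nlinarith [sq_pos_of_ne_zero h, sq_nonneg P.2]
  · nlinarith [sq_pos_of_ne_zero h, sq_nonneg P.1]

lemma continuous_shell : Continuous shell := by unfold shell; fun_prop

lemma abs_fst_le_shell (P : ℝ × ℝ) : |P.1| ≤ shell P :=
  Real.abs_le_sqrt (by nlinarith [sq_nonneg P.2])

lemma abs_snd_le_shell (P : ℝ × ℝ) : |P.2| ≤ shell P :=
  Real.abs_le_sqrt (by nlinarith [sq_nonneg P.1])

/-- The exponent 3 exceeds the dimension 2. In the sup norm 1 + ‖P‖ ≤ 2w, whence the constant 8. -/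
lemma integrable_shell_cube : Integrable fun P : ℝ × ℝ => 1 / shell P ^ 3 := by
  have h := (integrable_one_add_norm (E := ℝ × ℝ) (μ := volume) (r := 3)
    (by simp; norm_num)).const_mul 8
  refine h.mono' ((continuous_const.div (continuous_shell.pow 3)
    fun P => (pow_pos (shell_pos P) 3).ne').aestronglyMeasurable)
    (Eventually.of_forall fun P => ?_)
  have h1 : 1 + ‖P‖ ≤ 2 * shell P := by
    have : ‖P‖ ≤ shell P := by
      rw [Prod.norm_def, Real.norm_eq_abs, Real.norm_eq_abs]
      exact max_le (abs_fst_le_shell P) (abs_snd_le_shell P)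
    linarith [one_le_shell P]
  have hs := shell_pos P
  rw [Real.norm_of_nonneg (by positivity), Real.rpow_neg (by positivity),
    show (3 : ℝ) = ((3 : ℕ) : ℝ) by norm_num, Real.rpow_natCast, ← one_div, mul_one_div,
    div_le_div_iff₀ (by positivity) (by positivity)]
  calc 1 * (1 + ‖P‖) ^ 3 ≤ 1 * (2 * shell P) ^ 3 := by gcongr
    _ = 8 * shell P ^ 3 := by ring

/-- The properties of a waveform that the superposition over the mass shell depends on. -/
structure IsProfile (f : ℂ → ℂ) : Prop where
  continuousOn : ContinuousOn f closedUpperHalf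
  differentiableOn : DifferentiableOn ℂ f openUpperHalf
  decay : ∃ C : ℝ, ∀ θ ∈ openUpperHalf, ‖f θ‖ ≤ C / θ.im
  deriv_bounded : ∀ r : ℝ, ∃ M : ℝ, ∀ θ ∈ openUpperHalf, ‖θ‖ ≤ r → ‖deriv f θ‖ ≤ M

lemma IsProfile.deriv_decay {f : ℂ → ℂ} (hf : IsProfile f) :
    ∃ C : ℝ, ∀ θ ∈ openUpperHalf, ‖deriv f θ‖ ≤ C / θ.im ^ 2 := by
  obtain ⟨C, hC⟩ := hf.decay
  refine ⟨2 ^ (1 + 1) * C, fun θ hθ => ?_⟩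
  exact norm_deriv_le_of_norm_le_div_im_pow (n := 1) hf.differentiableOn
    (by simpa using hC) hθ

lemma IsProfile.differentiableOn_deriv {f : ℂ → ℂ} (hf : IsProfile f) :
    DifferentiableOn ℂ (deriv f) openUpperHalf :=
  hf.differentiableOn.deriv isOpen_openUpperHalf

/-- The phase `T w - x p - y q - Z` of the plane wave attached to a point of the mass shell. -/
noncomputable def shellPhase (T : ℂ) (x y : ℝ) (Z : ℂ) (P : ℝ × ℝ) : ℂ :=
  T * (shell P : ℝ) - (x : ℂ) * (P.1 : ℝ) - (y : ℂ) * (P.2 : ℝ) - Z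

section shell

variable {f : ℂ → ℂ} {b : ℝ} {T Z : ℂ}

lemma continuous_shellPhase (T : ℂ) (x y : ℝ) (Z : ℂ) : Continuous (shellPhase T x y Z) := by
  have := continuous_shell
  unfold shellPhase
  fun_prop

lemma le_shellPhase_im (hT : b ≤ T.im) (hZ : Z.im = b) (x y : ℝ) (P : ℝ × ℝ) :
    b * (shell P - 1) ≤ (shellPhase T x y Z P).im := by
  have : (shellPhase T x y Z P).im = T.im * shell P - b := by simp [shellPhase, hZ]
  rw [this]
  nlinarith [shell_pos P]

lemma shellPhase_mem (hb : 0 < b) (hT : b ≤ T.im) (hZ : Z.im = b) (x y : ℝ) {P : ℝ × ℝ}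
    (hP : P ≠ 0) : shellPhase T x y Z P ∈ openUpperHalf :=
  (mul_pos hb (sub_pos.mpr (one_lt_shell hP))).trans_le (le_shellPhase_im hT hZ x y P)

lemma shellPhase_norm_le (T : ℂ) (x y : ℝ) (Z : ℂ) (P : ℝ × ℝ) :
    ‖shellPhase T x y Z P‖ ≤ (‖T‖ + |x| + |y|) * shell P + ‖Z‖ := by
  have h0 := (shell_pos P).le
  have h1 := abs_fst_le_shell P
  have h2 := abs_snd_le_shell P
  refine (norm_sub_le _ _).trans (add_le_add_left ((norm_sub_le _ _).trans
    ((add_le_add_left (norm_sub_le _ _) _).trans ?_)) _)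
  simp only [norm_mul, Complex.norm_real, Real.norm_eq_abs, abs_of_nonneg h0]
  nlinarith [mul_le_mul_of_nonneg_left h1 (abs_nonneg x), mul_le_mul_of_nonneg_left h2 (abs_nonneg y)]

/-- Two regimes. For w ≤ 2 the phase may approach the real axis but stays bounded, so local
boundedness of f' applies. For w ≥ 2 one has w - 1 ≥ w/2, so the height is at least b w / 2 and the
decay of f' takes over. -/
lemma IsProfile.exists_deriv_shellPhase_le (hf : IsProfile f) (hb : 0 < b) (hT : b ≤ T.im)
    (hZ : Z.im = b) (x y : ℝ) :
    ∃ K : ℝ, 0 ≤ K ∧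
      ∀ P : ℝ × ℝ, P ≠ 0 → ‖deriv f (shellPhase T x y Z P)‖ ≤ K / shell P ^ 2 := by
  obtain ⟨C, hC⟩ := hf.deriv_decay
  obtain ⟨M, hM⟩ := hf.deriv_bounded ((‖T‖ + |x| + |y|) * 2 + ‖Z‖)
  have hC0 := nonneg_of_norm_le_div_im_pow hC
  refine ⟨4 * |M| + 4 * C / b ^ 2, by positivity, fun P hP => ?_⟩
  have hm := shellPhase_mem hb hT hZ x y hP
  have hs := shell_pos P
  rcases le_total (shell P) 2 with h | h
  · calc _ ≤ M := hM _ hm ((shellPhase_norm_le T x y Z P).trans (by gcongr))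
      _ ≤ |M| := le_abs_self M
      _ = 4 * |M| / 2 ^ 2 := by ring
      _ ≤ (4 * |M| + 4 * C / b ^ 2) / shell P ^ 2 := by
        gcongr
        exact le_add_of_nonneg_right (by positivity)
  · have h1 : b * (shell P / 2) ≤ (shellPhase T x y Z P).im :=
      le_trans (by gcongr; linarith) (le_shellPhase_im hT hZ x y P)
    calc _ ≤ C / (shellPhase T x y Z P).im ^ 2 := hC _ hm
      _ ≤ C / (b * (shell P / 2)) ^ 2 := by gcongr
      _ = (4 * C / b ^ 2) / shell P ^ 2 := by field_simp; ring
      _ ≤ _ := by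
        gcongr
        exact le_add_of_nonneg_left (by positivity)

lemma ae_ne_zero_prod : ∀ᵐ P : ℝ × ℝ, P ≠ 0 := by simp [ae_iff]

lemma IsProfile.integrable_shell (hf : IsProfile f) (hb : 0 < b) (hT : b ≤ T.im)
    (hZ : Z.im = b) (x y : ℝ) :
    Integrable fun P : ℝ × ℝ => deriv f (shellPhase T x y Z P) / (shell P : ℝ) := by
  obtain ⟨K, hK0, hK⟩ := hf.exists_deriv_shellPhase_le hb hT hZ x y
  refine (integrable_shell_cube.const_mul K).mono' ?_ ?_
  · exact (((measurable_deriv f).comp (continuous_shellPhase T x y Z).measurable).div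
      (Complex.continuous_ofReal.comp continuous_shell).measurable).aestronglyMeasurable
  · filter_upwards [ae_ne_zero_prod] with P hP
    have hs := shell_pos P
    rw [norm_div, Complex.norm_real, Real.norm_of_nonneg hs.le]
    calc _ ≤ K / shell P ^ 2 / shell P := by gcongr; exact hK P hP
      _ = K * (1 / shell P ^ 3) := by field_simp

/-- Freeze q and apply the one-variable result with a = 1 + q². The real term y q is absorbed into Z
without changing its imaginary part. The line q = 0, where a = 1, is null. -/
lemma IsProfile.integral_shell_boost_fst (hf : IsProfile f) (hb : 0 < b) (hT : b ≤ T.im)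
    (hZ : Z.im = b) (x y : ℝ) :
    ∫ P : ℝ × ℝ, deriv f (shellPhase T x y Z P) / (shell P : ℝ) =
      ∫ P : ℝ × ℝ, deriv f (shellPhase (upRoot (T ^ 2 - (x ^ 2 : ℝ))) 0 y Z P) / (shell P : ℝ) := by
  obtain ⟨C, hC⟩ := hf.deriv_decay
  have hT' := hT.trans (im_le_upRoot_im (hb.trans_le hT) (sq_nonneg x))
  have h1 := hf.integrable_shell hb hT hZ x y
  have h2 := hf.integrable_shell hb hT' hZ 0 y
  rw [Measure.volume_eq_prod] at h1 h2 ⊢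
  rw [integral_prod_symm _ h1, integral_prod_symm _ h2]
  refine integral_congr_ae ?_
  have : ∀ᵐ q : ℝ, q ≠ 0 := by simp [ae_iff]
  filter_upwards [this] with q hq
  have ha : 1 < 1 + q ^ 2 := by have := sq_pos_of_ne_zero hq; linarith
  have := integral_boost hf.differentiableOn_deriv hC ha hb hT
    (Z := Z + (y : ℂ) * (q : ℂ)) (by simp [hZ]) x
  simp only [shellPhase, shell]
  convert this using 4 with p p <;> rw [add_right_comm]
  · ring_nf
  · ring_nf
    simp

lemma IsProfile.integral_shell_boost_snd (hf : IsProfile f) (hb : 0 < b) (hT : b ≤ T.im)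
    (hZ : Z.im = b) (y : ℝ) :
    ∫ P : ℝ × ℝ, deriv f (shellPhase T 0 y Z P) / (shell P : ℝ) =
      ∫ P : ℝ × ℝ, deriv f (shellPhase (upRoot (T ^ 2 - (y ^ 2 : ℝ))) 0 0 Z P) / (shell P : ℝ) := by
  rw [Measure.volume_eq_prod, ← integral_prod_swap, ← Measure.volume_eq_prod]
  have e1 : ∀ P : ℝ × ℝ, shell P.swap = shell P := fun P => by simp [shell, add_right_comm]
  have e2 : ∀ P : ℝ × ℝ, shellPhase T 0 y Z P.swap = shellPhase T y 0 Z P := fun P => by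
    simp [shellPhase, e1]
  simp_rw [e1, e2]
  exact hf.integral_shell_boost_fst hb hT hZ y 0

lemma IsProfile.integral_shell_boost (hf : IsProfile f) (hb : 0 < b) (hT : b ≤ T.im)
    (hZ : Z.im = b) (x y : ℝ) :
    ∫ P : ℝ × ℝ, deriv f (shellPhase T x y Z P) / (shell P : ℝ) =
      ∫ P : ℝ × ℝ, deriv f (shellPhase (upRoot (T ^ 2 - (x ^ 2 + y ^ 2 : ℝ))) 0 0 Z P)
        / (shell P : ℝ) := by
  have hT' := hT.trans (im_le_upRoot_im (hb.trans_le hT) (sq_nonneg x))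
  rw [hf.integral_shell_boost_fst hb hT hZ, hf.integral_shell_boost_snd hb hT' hZ,
    upRoot_sq_sub_sub]

lemma radial_shell_phase (S Z : ℂ) (r : ℝ) :
    shellPhase S 0 0 Z (r, 0) = S * (√(1 + r ^ 2) : ℝ) - Z := by
  simp [shellPhase, shell]

lemma IsProfile.integrableOn_radial (hf : IsProfile f) (hb : 0 < b) (hT : b ≤ T.im)
    (hZ : Z.im = b) :
    IntegrableOn (fun r : ℝ => (r : ℂ) * (deriv f (T * (√(1 + r ^ 2) : ℝ) - Z)
      / (√(1 + r ^ 2) : ℝ))) (Ioi 0) := by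
  obtain ⟨K, hK0, hK⟩ := hf.exists_deriv_shellPhase_le hb hT hZ 0 0
  refine ((integrable_inv_one_add_sq.const_mul K).integrableOn).mono' ?_ ?_
  · refine Measurable.aestronglyMeasurable (Complex.measurable_ofReal.mul
      (((measurable_deriv f).comp ?_).div ?_)) <;> exact Continuous.measurable (by fun_prop)
  · filter_upwards [ae_restrict_mem measurableSet_Ioi] with r hr
    have hr0 : 0 < r := hr
    have h1 := hK (r, 0) (by simp [hr0.ne'])
    rw [radial_shell_phase] at h1
    have hs : shell (r, 0) = √(1 + r ^ 2) := by simp [shell]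
    have hs0 : 0 < √(1 + r ^ 2) := by positivity
    have hrs : r ≤ √(1 + r ^ 2) := Real.le_sqrt_of_sq_le (by linarith)
    rw [hs] at h1
    rw [norm_mul, norm_div, Complex.norm_real, Complex.norm_real, Real.norm_of_nonneg hs0.le,
      Real.norm_of_nonneg hr0.le]
    calc _ ≤ √(1 + r ^ 2) * (K / √(1 + r ^ 2) ^ 2 / √(1 + r ^ 2)) := by gcongr
      _ = K * (√(1 + r ^ 2) ^ 2)⁻¹ := by field_simp
      _ = K * (1 + r ^ 2)⁻¹ := by rw [Real.sq_sqrt (by positivity)]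

/-- Since r/w is dw/dr, the integrand is the derivative of f(T w - Z) / T. At r = 0 the phase may be
real, so only continuity of f is used there; at infinity the height grows at least like b(r - 1). -/
lemma IsProfile.integral_radial (hf : IsProfile f) (hb : 0 < b) (hT : b ≤ T.im)
    (hZ : Z.im = b) :
    ∫ r : ℝ in Ioi 0, (r : ℂ) * (deriv f (T * (√(1 + r ^ 2) : ℝ) - Z) / (√(1 + r ^ 2) : ℝ))
      = -(f (T - Z) / T) := by
  have hT0 : T ≠ 0 := by
    rintro rfl
    simp at hT
    linarith
  have him : ∀ r : ℝ, b * (√(1 + r ^ 2) - 1) ≤ (T * (√(1 + r ^ 2) : ℝ) - Z).im := by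
    intro r
    have := le_shellPhase_im hT hZ 0 0 (r, 0)
    rw [radial_shell_phase] at this
    simpa [shell] using this
  have hcl : ∀ r : ℝ, T * (√(1 + r ^ 2) : ℝ) - Z ∈ closedUpperHalf := fun r =>
    (mul_nonneg hb.le (sub_nonneg.mpr (by rw [Real.one_le_sqrt]; nlinarith))).trans (him r)
  have hop : ∀ r : ℝ, 0 < r → T * (√(1 + r ^ 2) : ℝ) - Z ∈ openUpperHalf := by
    intro r hr
    refine (mul_pos hb (sub_pos.mpr ?_)).trans_le (him r)
    rw [Real.lt_sqrt zero_le_one]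
    nlinarith
  have key := integral_Ioi_of_hasDerivAt_of_tendsto (a := 0) (m := 0)
    (f := fun r : ℝ => f (T * (√(1 + r ^ 2) : ℝ) - Z) / T)
    (f' := fun r : ℝ => (r : ℂ) * (deriv f (T * (√(1 + r ^ 2) : ℝ) - Z) / (√(1 + r ^ 2) : ℝ)))
    ?_ ?_ (hf.integrableOn_radial hb hT hZ) ?_
  · rw [key]
    simp
  · exact ((hf.continuousOn.comp_continuous (by fun_prop) hcl).div_const T).continuousWithinAt
  · intro r hr
    have h1 := (((hasDerivAt_sqrt_add_sq one_pos r).ofReal_comp).const_mul T).sub_const Z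
    have h2 := (hf.differentiableOn.differentiableAt
      (isOpen_openUpperHalf.mem_nhds (hop r hr))).hasDerivAt
    refine ((h2.comp r h1).div_const T).congr_deriv ?_
    push_cast
    field_simp
  · obtain ⟨C, hC⟩ := hf.decay
    have hC0 : 0 ≤ C := nonneg_of_norm_le_div_im_pow (n := 1) (by simpa using hC)
    rw [show (0 : ℂ) = 0 / T by simp]
    refine Tendsto.div_const ?_ T
    refine squeeze_zero_norm' (a := fun r : ℝ => C / (b * (r - 1))) ?_ ?_
    · filter_upwards [eventually_gt_atTop 1] with r hr
      refine (hC _ (hop r (by linarith))).trans ?_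
      have hrs : r ≤ √(1 + r ^ 2) := Real.le_sqrt_of_sq_le (by linarith)
      have : b * (r - 1) ≤ (T * (√(1 + r ^ 2) : ℝ) - Z).im :=
        le_trans (by gcongr) (him r)
      have : 0 < b * (r - 1) := mul_pos hb (by linarith)
      gcongr
    · exact ((tendsto_atTop_add_const_right _ (-1) tendsto_id).const_mul_atTop hb).const_div_atTop C

lemma shell_polarCoord_symm (P : ℝ × ℝ) : shell (polarCoord.symm P) = √(1 + P.1 ^ 2) := by
  rw [polarCoord_symm_apply, shell]
  congr 1
  nlinarith [Real.sin_sq_add_cos_sq P.2]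

/-- The superposition of plane waves over the mass shell is the quasi-spherical wave. -/
theorem IsProfile.integral_shell (hf : IsProfile f) (hb : 0 < b) (hT : b ≤ T.im)
    (hZ : Z.im = b) (x y : ℝ) :
    ∫ P : ℝ × ℝ, deriv f (shellPhase T x y Z P) / (shell P : ℝ) =
      -(2 * (Real.pi : ℂ)) * (f (upRoot (T ^ 2 - (x ^ 2 + y ^ 2 : ℝ)) - Z)
        / upRoot (T ^ 2 - (x ^ 2 + y ^ 2 : ℝ))) := by
  have hT' := hT.trans (im_le_upRoot_im (hb.trans_le hT) (by positivity : 0 ≤ x ^ 2 + y ^ 2))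
  rw [hf.integral_shell_boost hb hT hZ]
  generalize upRoot (T ^ 2 - (x ^ 2 + y ^ 2 : ℝ)) = S at hT' ⊢
  rw [← integral_comp_polarCoord_symm, polarCoord_target]
  have e : ∀ P : ℝ × ℝ, P.1 • (deriv f (shellPhase S 0 0 Z (polarCoord.symm P))
      / (shell (polarCoord.symm P) : ℝ)) =
      ((P.1 : ℂ) * (deriv f (S * (√(1 + P.1 ^ 2) : ℝ) - Z) / (√(1 + P.1 ^ 2) : ℝ))) * 1 := by
    intro P
    rw [shellPhase, shell_polarCoord_symm]
    simp
  simp_rw [e]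
  rw [Measure.volume_eq_prod, setIntegral_prod_mul
    (fun r : ℝ => (r : ℂ) * (deriv f (S * (√(1 + r ^ 2) : ℝ) - Z) / (√(1 + r ^ 2) : ℝ)))
    (fun _ => 1), hf.integral_radial hb hT' hZ]
  have hpi : ∫ _ in Ioo (-Real.pi) Real.pi, (1 : ℂ) = 2 * Real.pi := by
    simp [Real.pi_pos.le]
    ring
  rw [hpi]
  ring

end shell
-- Gnomonic coordinates and the surface measure
/-- The coordinates `(z, (x, y))` on three-space. -/
noncomputable def axialCoords : Space3 ≃ᵐ ℝ × (ℝ × ℝ) :=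
  (MeasurableEquiv.toLp 2 (Fin 3 → ℝ)).symm.trans
    ((MeasurableEquiv.piFinSuccAbove (fun _ : Fin 3 => ℝ) 2).trans
      ((MeasurableEquiv.refl ℝ).prodCongr MeasurableEquiv.finTwoArrow))

lemma axialCoords_apply (K : Space3) : axialCoords K = (K 2, (K 0, K 1)) := rfl

lemma axialCoords_symm_apply (k p q : ℝ) : axialCoords.symm (k, (p, q)) = !₂[p, q, k] := by
  rw [MeasurableEquiv.symm_apply_eq, axialCoords_apply]
  rfl

lemma measurePreserving_axialCoords : MeasurePreserving axialCoords := by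
  refine (EuclideanSpace.volume_preserving_symm_measurableEquiv_toLp (Fin 3)).trans ?_
  refine (volume_preserving_piFinSuccAbove (fun _ : Fin 3 => ℝ) 2).trans ?_
  exact (MeasurePreserving.id volume).prod (volume_preserving_finTwoArrow ℝ)

lemma norm_smul_shell (k : ℝ) (hk : 0 < k) (P : ℝ × ℝ) :
    ‖(!₂[k * P.1, k * P.2, k] : Space3)‖ = k * shell P := by
  rw [EuclideanSpace.norm_eq, Fin.sum_univ_three, shell]
  simp only [Real.norm_eq_abs, sq_abs, Matrix.cons_val_zero, Matrix.cons_val_one,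
    Matrix.cons_val]
  rw [show (k * P.1) ^ 2 + (k * P.2) ^ 2 + k ^ 2 = k ^ 2 * (1 + P.1 ^ 2 + P.2 ^ 2) by ring,
    Real.sqrt_mul (sq_nonneg k), Real.sqrt_sq hk.le]

/-- Gnomonic coordinates on the forward hemisphere: the central projection of the plane `z = 1`. -/
noncomputable def gnomonic (P : ℝ × ℝ) : Metric.sphere (0 : Space3) 1 :=
  ⟨!₂[(shell P)⁻¹ * P.1, (shell P)⁻¹ * P.2, (shell P)⁻¹], by
    rw [mem_sphere_zero_iff_norm, norm_smul_shell _ (inv_pos.mpr (shell_pos P)),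
      inv_mul_cancel₀ (shell_pos P).ne']⟩

lemma gnomonic_zero (P : ℝ × ℝ) : (gnomonic P : Space3) 0 = (shell P)⁻¹ * P.1 := rfl

lemma gnomonic_one (P : ℝ × ℝ) : (gnomonic P : Space3) 1 = (shell P)⁻¹ * P.2 := rfl

lemma gnomonic_two (P : ℝ × ℝ) : (gnomonic P : Space3) 2 = (shell P)⁻¹ := rfl

lemma measurable_gnomonic : Measurable gnomonic := by
  refine Measurable.subtype_mk ?_
  have h := continuous_shell.measurable.inv
  have h2 : Measurable fun P : ℝ × ℝ =>
      axialCoords.symm ((shell P)⁻¹, ((shell P)⁻¹ * P.1, (shell P)⁻¹ * P.2)) :=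
    axialCoords.symm.measurable.comp
      (h.prodMk ((h.mul measurable_fst).prodMk (h.mul measurable_snd)))
  simpa only [axialCoords_symm_apply] using h2

lemma smul_gnomonic (k : ℝ) (P : ℝ × ℝ) :
    (k * shell P) • (gnomonic P : Space3) = !₂[k * P.1, k * P.2, k] := by
  have h := (shell_pos P).ne'
  ext i
  fin_cases i
  · change k * shell P * ((shell P)⁻¹ * P.1) = k * P.1
    field_simp
  · change k * shell P * ((shell P)⁻¹ * P.2) = k * P.2
    field_simp
  · change k * shell P * (shell P)⁻¹ = k
    field_simp

lemma exists_gnomonic_eq (N : Metric.sphere (0 : Space3) 1) (hN : 0 < (N : Space3) 2) :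
    ∃ P, gnomonic P = N := by
  set n : Space3 := ↑N with hn
  refine ⟨(n 0 / n 2, n 1 / n 2), ?_⟩
  set P : ℝ × ℝ := (n 0 / n 2, n 1 / n 2) with hP
  have h1 : (!₂[n 2 * P.1, n 2 * P.2, n 2] : Space3) = n := by
    ext i
    fin_cases i
    · change n 2 * (n 0 / n 2) = n 0
      field_simp
    · change n 2 * (n 1 / n 2) = n 1
      field_simp
    · rfl
  have h2 := norm_smul_shell (n 2) hN P
  rw [h1, norm_eq_of_mem_sphere N] at h2
  have h3 := smul_gnomonic (n 2) P
  rw [← h2, one_smul, h1] at h3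
  exact Subtype.ext h3

section pointwise

open scoped Pointwise

/-- The surface measure is defined through the volume of the cone over a set. At height k the cone
is the k-fold dilate of the gnomonic picture, cut off where the distance k w from the origin reaches
1. -/
lemma axialCoords_image_cone (A : Set (Metric.sphere (0 : Space3) 1)) :
    axialCoords.symm ⁻¹' (Ioo (0 : ℝ) 1 • ((↑) '' (A ∩ {N | 0 < (N : Space3) 2}) : Set Space3)) =
      {z | 0 < z.1 ∧ ∃ P ∈ gnomonic ⁻¹' A, z.1 * shell P < 1 ∧ z.1 • P = z.2} := by
  ext ⟨k, x, y⟩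
  rw [mem_preimage, axialCoords_symm_apply, Set.mem_smul]
  constructor
  · rintro ⟨r, hr, _, ⟨N, ⟨hNA, hN⟩, rfl⟩, h⟩
    obtain ⟨P, rfl⟩ := exists_gnomonic_eq N hN
    have hs := shell_pos P
    have hr0 := hr.1
    have h' := smul_gnomonic (r / shell P) P
    rw [div_mul_cancel₀ _ hs.ne', h] at h'
    have e0 : x = r / shell P * P.1 := congrArg (fun v : Space3 => v 0) h'
    have e1 : y = r / shell P * P.2 := congrArg (fun v : Space3 => v 1) h'
    have e2 : k = r / shell P := congrArg (fun v : Space3 => v 2) h'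
    refine ⟨by rw [e2]; exact div_pos hr0 hs, P, hNA, ?_, ?_⟩
    · simp only [e2]
      rw [div_mul_cancel₀ _ hs.ne']
      exact hr.2
    · simp only [e0, e1, e2]
      rfl
  · rintro ⟨hk, P, hPA, hlt, h⟩
    simp only at hk hlt h
    have hs := shell_pos P
    refine ⟨k * shell P, ⟨mul_pos hk hs, hlt⟩, gnomonic P, ⟨gnomonic P, ⟨hPA, ?_⟩, rfl⟩, ?_⟩
    · change 0 < (gnomonic P : Space3) 2
      rw [gnomonic_two]
      exact inv_pos.mpr hs
    · rw [smul_gnomonic]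
      have e0 : k * P.1 = x := congrArg Prod.fst h
      have e1 : k * P.2 = y := congrArg Prod.snd h
      rw [e0, e1]

lemma lintegral_sq_Ioo {c : ℝ} (hc : 0 ≤ c) :
    ∫⁻ k in Ioo 0 c, ENNReal.ofReal (k ^ 2) = ENNReal.ofReal (c ^ 3 / 3) := by
  rw [Measure.restrict_congr_set Ioo_ae_eq_Ioc,
    ← ofReal_integral_eq_lintegral_ofReal (intervalIntegral.intervalIntegrable_pow 2).1
      (Eventually.of_forall fun k => sq_nonneg k), ← intervalIntegral.integral_of_le hc, integral_pow]
  norm_num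

lemma measurableSet_forward :
    MeasurableSet {N : Metric.sphere (0 : Space3) 1 | 0 < (N : Space3) 2} := by
  refine measurableSet_lt measurable_const ?_
  exact (Continuous.comp (by fun_prop : Continuous fun v : Space3 => v 2)
    continuous_subtype_val).measurable

lemma volume_smul_slice (B : Set (ℝ × ℝ)) (k : ℝ) (hk : 0 < k) :
    volume {v : ℝ × ℝ | ∃ P ∈ B, k * shell P < 1 ∧ k • P = v} =
      ENNReal.ofReal (k ^ 2) * volume (B ∩ {P | k * shell P < 1}) := by
  have : {v : ℝ × ℝ | ∃ P ∈ B, k * shell P < 1 ∧ k • P = v} =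
      k • (B ∩ {P | k * shell P < 1}) := by
    ext v
    simp [Set.mem_smul_set, and_assoc]
  rw [this, Measure.addHaar_smul]
  simp [abs_of_pos hk]

/-- In gnomonic coordinates the surface element of the forward hemisphere is `w⁻³ dp dq`. -/
theorem surfaceMeasure_restrict_forward :
    surfaceMeasure.restrict {N | 0 < (N : Space3) 2} =
      (volume.withDensity fun P => ENNReal.ofReal (1 / shell P ^ 3)).map gnomonic := by
  ext A hA
  have hB : MeasurableSet (gnomonic ⁻¹' A) := measurable_gnomonic hA
  rw [Measure.restrict_apply hA, Measure.map_apply measurable_gnomonic hA, withDensity_apply _ hB,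
    surfaceMeasure, Measure.toSphere_apply' _ (hA.inter measurableSet_forward),
    ← measurePreserving_axialCoords.symm.measure_preimage_equiv, axialCoords_image_cone,
    finrank_euclideanSpace_fin]
  set B := gnomonic ⁻¹' A
  have hmeas : MeasurableSet {z : ℝ × (ℝ × ℝ) |
      0 < z.1 ∧ ∃ P ∈ B, z.1 * shell P < 1 ∧ z.1 • P = z.2} := by
    -- Solving for P = k⁻¹ v removes the existential, so measurability follows by preimages.
    have : {z : ℝ × (ℝ × ℝ) | 0 < z.1 ∧ ∃ P ∈ B, z.1 * shell P < 1 ∧ z.1 • P = z.2} =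
        {z | 0 < z.1} ∩ ((fun z : ℝ × (ℝ × ℝ) => z.1⁻¹ • z.2) ⁻¹' B ∩
          {z | z.1 * shell (z.1⁻¹ • z.2) < 1}) := by
      ext ⟨k, v⟩
      refine and_congr_right fun hk => ?_
      have hk0 : k ≠ 0 := ne_of_gt hk
      constructor
      · rintro ⟨P, hP, hlt, h⟩
        have hv : k⁻¹ • v = P := by rw [show v = k • P from h.symm, inv_smul_smul₀ hk0]
        change k⁻¹ • v ∈ B ∧ k * shell (k⁻¹ • v) < 1
        rw [hv]
        exact ⟨hP, hlt⟩
      · rintro ⟨h1, h2⟩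
        exact ⟨_, h1, h2, smul_inv_smul₀ hk0 v⟩
    rw [this]
    have hm : Measurable fun z : ℝ × (ℝ × ℝ) => z.1⁻¹ • z.2 :=
      measurable_fst.inv.smul measurable_snd
    exact (measurableSet_lt measurable_const measurable_fst).inter ((hm hB).inter
      (measurableSet_lt (measurable_fst.mul (continuous_shell.measurable.comp hm))
        measurable_const))
  rw [Measure.volume_eq_prod, Measure.prod_apply hmeas]
  have hslice : ∀ k : ℝ, volume (Prod.mk k ⁻¹' {z : ℝ × (ℝ × ℝ) |
      0 < z.1 ∧ ∃ P ∈ B, z.1 * shell P < 1 ∧ z.1 • P = z.2}) =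
      (Ioi (0 : ℝ)).indicator
        (fun k => ENNReal.ofReal (k ^ 2) * volume (B ∩ {P | k * shell P < 1})) k := by
    intro k
    by_cases hk : 0 < k
    · rw [indicator_of_mem (mem_Ioi.mpr hk), ← volume_smul_slice B k hk]
      congr 1
      ext v
      simp [hk]
    · rw [indicator_of_notMem (by simpa using hk)]
      convert measure_empty (μ := (volume : Measure (ℝ × ℝ)))
      ext v
      simp [hk]
  simp_rw [hslice]
  rw [lintegral_indicator measurableSet_Ioi]
  have hlt : MeasurableSet {z : ℝ × (ℝ × ℝ) | z.1 * shell z.2 < 1} :=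
    measurableSet_lt (measurable_fst.mul (continuous_shell.measurable.comp measurable_snd))
      measurable_const
  have hcyl : ∀ k : ℝ, ENNReal.ofReal (k ^ 2) * volume (B ∩ {P | k * shell P < 1}) =
      ∫⁻ P in B, {z : ℝ × (ℝ × ℝ) | z.1 * shell z.2 < 1}.indicator
        (fun z => ENNReal.ofReal (z.1 ^ 2)) (k, P) := by
    intro k
    have hm : MeasurableSet {P : ℝ × ℝ | k * shell P < 1} := measurable_prodMk_left hlt
    have : ∀ P : ℝ × ℝ, {z : ℝ × (ℝ × ℝ) | z.1 * shell z.2 < 1}.indicator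
        (fun z => ENNReal.ofReal (z.1 ^ 2)) (k, P) =
        {P : ℝ × ℝ | k * shell P < 1}.indicator (fun _ => ENNReal.ofReal (k ^ 2)) P := fun P => rfl
    simp_rw [this]
    rw [lintegral_indicator_const hm, Measure.restrict_apply hm, inter_comm]
  simp_rw [hcyl]
  -- Over a fixed P the heights fill 0 < k < 1/w, and k² integrates to w⁻³/3; the dimension factor 3
  -- of the surface measure cancels the third.
  rw [lintegral_lintegral_swap]
  · have hin : ∀ P : ℝ × ℝ, ∫⁻ k in Ioi (0 : ℝ), {z : ℝ × (ℝ × ℝ) | z.1 * shell z.2 < 1}.indicator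
        (fun z => ENNReal.ofReal (z.1 ^ 2)) (k, P) = ENNReal.ofReal (1 / shell P ^ 3 / 3) := by
      intro P
      have hs := shell_pos P
      have h1 : ∀ k : ℝ, {z : ℝ × (ℝ × ℝ) | z.1 * shell z.2 < 1}.indicator
          (fun z => ENNReal.ofReal (z.1 ^ 2)) (k, P) =
          (Iio (shell P)⁻¹).indicator (fun k => ENNReal.ofReal (k ^ 2)) k := by
        intro k
        have : k * shell P < 1 ↔ k < (shell P)⁻¹ := by rw [← one_div, lt_div_iff₀ hs]
        simp only [indicator_apply, mem_ofPred_eq, mem_Iio, this]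
      simp_rw [h1]
      rw [lintegral_indicator measurableSet_Iio, Measure.restrict_restrict measurableSet_Iio,
        Iio_inter_Ioi, lintegral_sq_Ioo (inv_pos.mpr hs).le, inv_pow, one_div]
    simp_rw [hin]
    rw [← lintegral_const_mul _ (by have := continuous_shell.measurable; fun_prop)]
    refine lintegral_congr fun P => ?_
    have hs := shell_pos P
    rw [show ((3 : ℕ) : ENNReal) = ENNReal.ofReal 3 by norm_num,
      ← ENNReal.ofReal_mul (by norm_num)]
    congr 1
    field_simp
  · refine Measurable.aemeasurable ?_
    exact Measurable.indicator (by fun_prop) hlt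

end pointwise

/-! ### The forward hemisphere and the derivative of the far field -/

lemma inner_gnomonic (P : ℝ × ℝ) (R : Space3) :
    inner ℝ (gnomonic P : Space3) R = (shell P)⁻¹ * (P.1 * R 0 + P.2 * R 1 + R 2) := by
  rw [PiLp.inner_apply, Fin.sum_univ_three, gnomonic_zero, gnomonic_one, gnomonic_two]
  simp only [RCLike.inner_apply, conj_trivial]
  ring

lemma continuous_space3_apply (i : Fin 3) : Continuous fun K : Space3 => K i := by fun_prop

/-- The integrand of the superposition of plane waves over the forward hemisphere. -/
noncomputable def forwardIntegrand (f : ℂ → ℂ) (c b t : ℝ) (R : Space3)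
    (N : Metric.sphere (0 : Space3) 1) : ℂ :=
  1 / ((((N : Space3) 2 : ℝ) : ℂ)) ^ 2 *
    deriv f ((((c * t - inner ℝ (N : Space3) R : ℝ) : ℂ)
      + Complex.I * (b : ℝ) * (1 - ((N : Space3) 2 : ℝ))) / ((N : Space3) 2 : ℝ))

lemma measurable_forwardIntegrand (f : ℂ → ℂ) (c b t : ℝ) (R : Space3) :
    Measurable (forwardIntegrand f c b t R) := by
  have h2 : Measurable fun N : Metric.sphere (0 : Space3) 1 => (((N : Space3) 2 : ℝ) : ℂ) :=
    (Complex.continuous_ofReal.comp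
      ((continuous_space3_apply 2).comp continuous_subtype_val)).measurable
  have hi : Measurable fun N : Metric.sphere (0 : Space3) 1 =>
      ((c * t - inner ℝ (N : Space3) R : ℝ) : ℂ) :=
    Continuous.measurable (by fun_prop)
  exact (measurable_const.div (h2.pow_const 2)).mul ((measurable_deriv f).comp
    ((hi.add (measurable_const.mul (measurable_const.sub h2))).div h2))

/-- The density w⁻³ meets cos⁻² 𝒳 = w² and leaves 1/w; dividing the argument by cos 𝒳 = 1/w turns it
into the shell phase. -/
lemma density_smul_forwardIntegrand (f : ℂ → ℂ) (c b t : ℝ) (R : Space3) (P : ℝ × ℝ) :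
    (ENNReal.ofReal (1 / shell P ^ 3)).toReal • forwardIntegrand f c b t R (gnomonic P) =
      deriv f (shellPhase ((c * t : ℝ) + Complex.I * (b : ℝ)) (R 0) (R 1)
        ((R 2 : ℝ) + Complex.I * (b : ℝ)) P) / (shell P : ℝ) := by
  have hs := shell_pos P
  have hs' := shell_ne_zero P
  rw [ENNReal.toReal_ofReal (by positivity), forwardIntegrand, inner_gnomonic, gnomonic_two]
  have e : ((((c * t - (shell P)⁻¹ * (P.1 * R 0 + P.2 * R 1 + R 2) : ℝ) : ℂ)
      + Complex.I * (b : ℝ) * (1 - ((shell P)⁻¹ : ℝ))) / ((shell P)⁻¹ : ℝ)) =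
      shellPhase ((c * t : ℝ) + Complex.I * (b : ℝ)) (R 0) (R 1)
        ((R 2 : ℝ) + Complex.I * (b : ℝ)) P := by
    rw [shellPhase]
    push_cast
    field_simp
    ring
  rw [e, Complex.real_smul]
  push_cast
  field_simp

lemma measurable_shell_density : Measurable fun P => ENNReal.ofReal (1 / shell P ^ 3) := by
  have := continuous_shell.measurable
  fun_prop

section forward

variable {f : ℂ → ℂ} {b : ℝ}

lemma waveT_im (c b t : ℝ) : ((c * t : ℝ) + Complex.I * (b : ℝ) : ℂ).im = b := by simp

lemma IsProfile.integrableOn_forward (hf : IsProfile f) (hb : 0 < b) (c t : ℝ) (R : Space3) :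
    IntegrableOn (forwardIntegrand f c b t R) {N | 0 < (N : Space3) 2} surfaceMeasure := by
  rw [IntegrableOn, surfaceMeasure_restrict_forward, integrable_map_measure
    (measurable_forwardIntegrand f c b t R).aestronglyMeasurable measurable_gnomonic.aemeasurable,
    integrable_withDensity_iff_integrable_smul' measurable_shell_density
      (Eventually.of_forall fun _ => ENNReal.ofReal_lt_top)]
  simp only [Function.comp_apply, density_smul_forwardIntegrand]
  exact hf.integrable_shell hb (waveT_im c b t).ge (by simp) _ _

lemma integral_forward (f : ℂ → ℂ) (c b t : ℝ) (R : Space3) :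
    ∫ N in {N | 0 < (N : Space3) 2}, forwardIntegrand f c b t R N ∂surfaceMeasure =
      ∫ P, deriv f (shellPhase ((c * t : ℝ) + Complex.I * (b : ℝ)) (R 0) (R 1)
        ((R 2 : ℝ) + Complex.I * (b : ℝ)) P) / (shell P : ℝ) := by
  rw [surfaceMeasure_restrict_forward, integral_map measurable_gnomonic.aemeasurable
    (measurable_forwardIntegrand f c b t R).aestronglyMeasurable,
    integral_withDensity_eq_integral_toReal_smul measurable_shell_density
      (Eventually.of_forall fun _ => ENNReal.ofReal_lt_top)]
  simp only [density_smul_forwardIntegrand]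

lemma IsProfile.integral_shell_eq_quasiWave (hf : IsProfile f) (hb : 0 < b) (c t : ℝ)
    (R : Space3) :
    ∫ P, deriv f (shellPhase ((c * t : ℝ) + Complex.I * (b : ℝ)) (R 0) (R 1)
        ((R 2 : ℝ) + Complex.I * (b : ℝ)) P) / (shell P : ℝ) =
      -(2 * (Real.pi : ℂ)) * quasiWave f c b t R := by
  rw [hf.integral_shell hb (waveT_im c b t).ge (by simp), quasiWave, quasiPhase,
    quasiS_eq_upRoot, rhoSq, sub_sub]

lemma eq_neg_one_div_mul_of_integral {I u : ℂ} (h : I = -(2 * (Real.pi : ℂ)) * u) :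
    u = -(1 / (2 * (Real.pi : ℂ))) * I := by
  have : (Real.pi : ℂ) ≠ 0 := by exact_mod_cast Real.pi_ne_zero
  rw [h]
  field_simp

/-- The pole is the image of P = 0, a null point. It must be discarded because there the argument of
f is real, where the unrestricted derivative is not controlled. -/
lemma ae_forward_lt_one :
    ∀ᵐ N : Metric.sphere (0 : Space3) 1 ∂surfaceMeasure,
      N ∈ {N : Metric.sphere (0 : Space3) 1 | 0 < (N : Space3) 2} → (N : Space3) 2 < 1 := by
  rw [← ae_restrict_iff' measurableSet_forward, surfaceMeasure_restrict_forward,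
    ae_map_iff measurable_gnomonic.aemeasurable]
  · refine (withDensity_absolutelyContinuous _ _).ae_le ?_
    filter_upwards [ae_ne_zero_prod] with P hP
    rw [gnomonic_two]
    exact inv_lt_one_of_one_lt₀ (one_lt_shell hP)
  · exact measurableSet_lt
      ((continuous_space3_apply 2).comp continuous_subtype_val).measurable measurable_const

/-- The chain rule contributes -1/cos χ on top of the prefactor 1/cos χ. The bound cos χ < 1 puts
the argument in the open half-plane, where f is differentiable. -/
lemma IsProfile.deriv_farField (hf : IsProfile f) (hb : 0 < b) (n : Space3) (h0 : 0 < n 2)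
    (h1 : n 2 < 1) (s : ℝ) :
    deriv (fun s : ℝ => farField f b s n) s = -(1 / ((n 2 : ℝ) : ℂ) ^ 2 *
      deriv f ((-(s : ℂ) + Complex.I * (b : ℝ) * (1 - (n 2 : ℝ))) / (n 2 : ℝ))) := by
  have hn : ((n 2 : ℝ) : ℂ) ≠ 0 := by exact_mod_cast h0.ne'
  have hmem : (-(s : ℂ) + Complex.I * (b : ℝ) * (1 - (n 2 : ℝ))) / (n 2 : ℝ) ∈ openUpperHalf := by
    have : ((-(s : ℂ) + Complex.I * (b : ℝ) * (1 - (n 2 : ℝ))) / (n 2 : ℝ)).im =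
        b * (1 - n 2) / n 2 := by
      rw [Complex.div_ofReal_im]
      simp
    change 0 < Complex.im _
    rw [this]
    exact div_pos (mul_pos hb (sub_pos.mpr h1)) h0
  have hd := (hf.differentiableOn.differentiableAt
    (isOpen_openUpperHalf.mem_nhds hmem)).hasDerivAt
  have ha : HasDerivAt (fun s : ℝ =>
      (-(s : ℂ) + Complex.I * (b : ℝ) * (1 - (n 2 : ℝ))) / (n 2 : ℝ)) (-1 / (n 2 : ℝ)) s := by
    have := (((hasDerivAt_id s).ofReal_comp.neg).add_const
      (Complex.I * (b : ℝ) * (1 - (n 2 : ℝ)))).div_const ((n 2 : ℝ) : ℂ)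
    simpa using this
  have key := ((hd.comp s ha).const_mul (heavisideStep (n 2) / (n 2 : ℝ))).deriv
  refine Eq.trans key ?_
  rw [heavisideStep, if_pos h0]
  field_simp

lemma deriv_farField_of_nonpos (f : ℂ → ℂ) (b : ℝ) (n : Space3) (h : ¬ 0 < n 2) (s : ℝ) :
    deriv (fun s : ℝ => farField f b s n) s = 0 := by
  have : (fun s : ℝ => farField f b s n) = fun _ => 0 := by
    funext s
    simp [farField, heavisideStep, h]
  rw [this, deriv_const]

lemma IsProfile.deriv_farField_ae_eq (hf : IsProfile f) (hb : 0 < b) (c t : ℝ) (R : Space3) :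
    (fun N : Metric.sphere (0 : Space3) 1 =>
      deriv (fun s : ℝ => farField f b s N) (inner ℝ (N : Space3) R - c * t)) =ᵐ[surfaceMeasure]
    {N : Metric.sphere (0 : Space3) 1 | 0 < (N : Space3) 2}.indicator
      fun N => -forwardIntegrand f c b t R N := by
  filter_upwards [ae_forward_lt_one] with N hN
  by_cases h : 0 < (N : Space3) 2
  · rw [indicator_of_mem (by exact h), hf.deriv_farField hb _ h (hN h), forwardIntegrand,
      ← Complex.ofReal_neg, neg_sub]
  · rw [indicator_of_notMem (by exact h), deriv_farField_of_nonpos _ _ _ h]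

lemma IsProfile.integrable_deriv_farField (hf : IsProfile f) (hb : 0 < b) (c t : ℝ)
    (R : Space3) :
    Integrable (fun N : Metric.sphere (0 : Space3) 1 =>
      deriv (fun s : ℝ => farField f b s N) (inner ℝ (N : Space3) R - c * t)) surfaceMeasure := by
  rw [integrable_congr (hf.deriv_farField_ae_eq hb c t R),
    integrable_indicator_iff measurableSet_forward]
  exact (hf.integrableOn_forward hb c t R).neg

lemma IsProfile.integral_deriv_farField (hf : IsProfile f) (hb : 0 < b) (c t : ℝ)
    (R : Space3) :
    ∫ N : Metric.sphere (0 : Space3) 1,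
      deriv (fun s : ℝ => farField f b s N) (inner ℝ (N : Space3) R - c * t) ∂surfaceMeasure =
    -∫ N in {N | 0 < (N : Space3) 2}, forwardIntegrand f c b t R N ∂surfaceMeasure := by
  rw [integral_congr_ae (hf.deriv_farField_ae_eq hb c t R),
    integral_indicator measurableSet_forward, integral_neg]

end forward

/-! ### Spherical coordinates -/

lemma tan_image_Ioo : Real.tan '' Ioo 0 (Real.pi / 2) = Ioi 0 := by
  ext x
  constructor
  · rintro ⟨y, hy, rfl⟩
    exact Real.tan_pos_of_pos_of_lt_pi_div_two hy.1 hy.2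
  · intro hx
    exact ⟨Real.arctan x, ⟨Real.arctan_pos.mpr hx, Real.arctan_lt_pi_div_two x⟩,
      Real.tan_arctan x⟩

/-- The gnomonic radius of a direction is the tangent of its polar angle, so this substitution
passes from the plane to the sphere. -/
lemma integral_Ioi_eq_integral_tan {E : Type*} [NormedAddCommGroup E] [NormedSpace ℝ E]
    (g : ℝ → E) :
    ∫ r in Ioi 0, g r = ∫ χ in (0 : ℝ)..(Real.pi / 2), (1 / Real.cos χ ^ 2) • g (Real.tan χ) := by
  have hcos : ∀ χ ∈ Ioo 0 (Real.pi / 2), 0 < Real.cos χ := fun χ hχ =>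
    Real.cos_pos_of_mem_Ioo ⟨by linarith [hχ.1, Real.pi_pos], hχ.2⟩
  rw [← tan_image_Ioo, integral_image_eq_integral_abs_deriv_smul measurableSet_Ioo
    (fun χ hχ => (Real.hasDerivAt_tan (hcos χ hχ).ne').hasDerivWithinAt)
    (Real.injOn_tan.mono (Ioo_subset_Ioo_left (by linarith [Real.pi_pos]))),
    intervalIntegral.integral_of_le Real.pi_div_two_pos.le, integral_Ioc_eq_integral_Ioo]
  refine setIntegral_congr_fun measurableSet_Ioo fun χ hχ => ?_
  rw [abs_of_pos (by have := hcos χ hχ; positivity)]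

/-- Integrability in polar coordinates is what allows Fubini to separate the angle from the radius.
-/
lemma integrableOn_polarCoord_target {E : Type*} [NormedAddCommGroup E] [NormedSpace ℝ E]
    {g : ℝ × ℝ → E} (hg : Integrable g) :
    IntegrableOn (fun p : ℝ × ℝ => p.1 • g (polarCoord.symm p)) polarCoord.target := by
  have h := (integrableOn_image_iff_integrableOn_abs_det_fderiv_smul volume
    polarCoord.open_target.measurableSet
    (fun p _ => (hasFDerivAt_polarCoord_symm p).hasFDerivWithinAt)
    polarCoord.symm.injOn g).mp hg.integrableOn
  refine h.congr_fun (fun p hp => ?_) polarCoord.open_target.measurableSet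
  simp only [det_fderivPolarCoordSymm]
  rw [abs_of_pos hp.1]

lemma integral_eq_integral_polar {E : Type*} [NormedAddCommGroup E] [NormedSpace ℝ E]
    {g : ℝ × ℝ → E} (hg : Integrable g) :
    ∫ P, g P = ∫ φ in (-Real.pi)..Real.pi, ∫ r in Ioi 0,
      r • g (r * Real.cos φ, r * Real.sin φ) := by
  have h := integrableOn_polarCoord_target hg
  rw [← integral_comp_polarCoord_symm]
  rw [IntegrableOn] at h
  rw [polarCoord_target, Measure.volume_eq_prod, ← Measure.prod_restrict] at h ⊢
  rw [integral_prod_symm _ h, intervalIntegral.integral_of_le (by linarith [Real.pi_pos]),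
    integral_Ioc_eq_integral_Ioo]
  rfl

/-- With (p, q) = tan χ (cos φ, sin φ) one has w = 1/cos χ, and the Jacobian factors combine as tan
χ · cos χ / cos² χ = sin χ / cos² χ. -/
lemma IsProfile.integral_shell_spherical {f : ℂ → ℂ} {b : ℝ} {T Z : ℂ} (hf : IsProfile f)
    (hb : 0 < b) (hT : b ≤ T.im) (hZ : Z.im = b) (x y : ℝ) :
    ∫ P : ℝ × ℝ, deriv f (shellPhase T x y Z P) / (shell P : ℝ) =
      ∫ φ in (-Real.pi)..Real.pi, ∫ χ in (0 : ℝ)..(Real.pi / 2),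
        ((Real.sin χ / Real.cos χ ^ 2 : ℝ) : ℂ) *
          deriv f ((T - Z * (Real.cos χ : ℝ)
            - (((x * Real.cos φ + y * Real.sin φ) * Real.sin χ : ℝ) : ℂ)) / (Real.cos χ : ℝ)) := by
  rw [integral_eq_integral_polar (hf.integrable_shell hb hT hZ x y)]
  refine intervalIntegral.integral_congr fun φ _ => ?_
  rw [integral_Ioi_eq_integral_tan, intervalIntegral.integral_of_le Real.pi_div_two_pos.le,
    intervalIntegral.integral_of_le Real.pi_div_two_pos.le, integral_Ioc_eq_integral_Ioo,
    integral_Ioc_eq_integral_Ioo]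
  refine setIntegral_congr_fun measurableSet_Ioo fun χ hχ => ?_
  have hcos : 0 < Real.cos χ :=
    Real.cos_pos_of_mem_Ioo ⟨by linarith [hχ.1, Real.pi_pos], hχ.2⟩
  have hcos' : (Real.cos χ : ℂ) ≠ 0 := by exact_mod_cast hcos.ne'
  have hs : shell (Real.tan χ * Real.cos φ, Real.tan χ * Real.sin φ) = (Real.cos χ)⁻¹ := by
    rw [shell, ← Real.sqrt_sq (inv_pos.mpr hcos).le]
    congr 1
    rw [Real.tan_eq_sin_div_cos]
    field_simp
    have h1 := Real.sin_sq_add_cos_sq φ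
    have h2 := Real.sin_sq_add_cos_sq χ
    linear_combination h2 + Real.sin χ ^ 2 * h1
  have ha : shellPhase T x y Z (Real.tan χ * Real.cos φ, Real.tan χ * Real.sin φ) =
      (T - Z * (Real.cos χ : ℝ)
        - (((x * Real.cos φ + y * Real.sin φ) * Real.sin χ : ℝ) : ℂ)) / (Real.cos χ : ℝ) := by
    rw [shellPhase, hs, Real.tan_eq_sin_div_cos]
    push_cast at hcos' ⊢
    field_simp
    ring
  simp only [ha, hs]
  rw [Complex.real_smul, Complex.real_smul, Real.tan_eq_sin_div_cos]
  push_cast at hcos' ⊢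
  field_simp

/-! ### The far-field limit along a ray -/

section farfield

variable {f : ℂ → ℂ}

/-- The product of the real and imaginary parts of the root is Re T · Im T > 0. This fixes the sign
of the root at late times. -/
lemma zero_lt_upRoot_re {T : ℂ} (hT : 0 < T.im) (hT' : 0 < T.re) {r : ℝ} (hr : 0 ≤ r) :
    0 < (upRoot (T ^ 2 - r)).re := by
  have h := congrArg Complex.im (upRoot_sq (T ^ 2 - r))
  have hi := upRoot_sq_sub_im_pos hT hr
  generalize upRoot (T ^ 2 - r) = w at h hi ⊢
  simp only [sq, Complex.mul_im, Complex.sub_im, Complex.ofReal_im] at h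
  have : 0 < T.re * T.im := mul_pos hT' hT
  by_contra! hle
  nlinarith [mul_nonneg (neg_nonneg.mpr hle) hi.le]

lemma tendsto_ofReal_inv_atTop : Tendsto (fun τ : ℝ => ((τ⁻¹ : ℝ) : ℂ)) atTop (𝓝 0) := by
  rw [← Complex.ofReal_zero]
  exact (Complex.continuous_ofReal.tendsto 0).comp tendsto_inv_atTop_zero

/-- The root `S` on the ray of direction cosine `ν`, as a function of `τ = ct`. -/
noncomputable def rayS (b s ν τ : ℝ) : ℂ :=
  upRoot (((τ : ℝ) + Complex.I * (b : ℝ)) ^ 2 - (((τ + s) ^ 2 * (1 - ν ^ 2) : ℝ) : ℂ))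

variable {b s ν : ℝ}

lemma rayS_sq_div (b s ν : ℝ) {τ : ℝ} (hτ : 0 < τ) :
    (rayS b s ν τ / τ) ^ 2 = (1 + Complex.I * b * (τ⁻¹ : ℝ)) ^ 2
      - (1 + s * (τ⁻¹ : ℝ)) ^ 2 * (1 - ν ^ 2) := by
  have : (τ : ℂ) ≠ 0 := by exact_mod_cast hτ.ne'
  rw [div_pow, rayS, upRoot_sq]
  push_cast
  field_simp

/-- The square of the ratio tends to ν². Its real part is positive for τ > 0, so the ratio is the
principal root of its square, and the limit is |ν| rather than ν. -/
lemma tendsto_rayS_div (hb : 0 < b) (hν : ν ^ 2 ≤ 1) (h0 : ν ≠ 0) :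
    Tendsto (fun τ : ℝ => rayS b s ν τ / τ) atTop (𝓝 ((|ν| : ℝ) : ℂ)) := by
  have hsq : Tendsto (fun τ : ℝ => (1 + Complex.I * b * ((τ⁻¹ : ℝ) : ℂ)) ^ 2
      - (1 + s * ((τ⁻¹ : ℝ) : ℂ)) ^ 2 * (1 - (ν : ℂ) ^ 2)) atTop (𝓝 (((|ν| : ℝ) : ℂ) ^ 2)) := by
    have hc : Continuous fun z : ℂ => (1 + Complex.I * b * z) ^ 2
      - (1 + s * z) ^ 2 * (1 - (ν : ℂ) ^ 2) := by fun_prop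
    have := (hc.tendsto 0).comp tendsto_ofReal_inv_atTop
    refine this.trans_eq ?_
    congr 1
    rw [← Complex.ofReal_pow |ν|, sq_abs]
    push_cast
    ring
  have hpos : 0 < |ν| := abs_pos.mpr h0
  have hroot := (continuousAt_cpow_const (b := ((2 : ℂ)⁻¹)) (a := ((|ν| : ℝ) : ℂ) ^ 2) (by
    rw [← Complex.ofReal_pow]
    exact Complex.ofReal_mem_slitPlane.mpr (by positivity))).tendsto.comp hsq
  rw [Complex.sq_cpow_two_inv (by simpa using hpos)] at hroot
  refine hroot.congr' ?_
  filter_upwards [eventually_gt_atTop 0] with τ hτ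
  simp only [Function.comp_apply]
  rw [← rayS_sq_div b s ν hτ, Complex.sq_cpow_two_inv]
  rw [Complex.div_ofReal_re]
  refine div_pos (zero_lt_upRoot_re (by simpa using hb) (by simpa using hτ) ?_) hτ
  exact mul_nonneg (sq_nonneg _) (by linarith)

/-- S - τν is a difference of growing terms. Rationalise it as (S² - τ²ν²) / (S + τν) and divide
through by τ: the τ² terms cancel and the denominator tends to 2ν. -/
lemma tendsto_rayPhase_of_pos (hb : 0 < b) (hν : ν ^ 2 ≤ 1) (h0 : 0 < ν) :
    Tendsto (fun τ : ℝ => rayS b s ν τ - ((τ + s) * ν : ℝ) - Complex.I * b) atTop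
      (𝓝 ((-(s : ℂ) + Complex.I * b * (1 - ν)) / ν)) := by
  have hν0 : (ν : ℂ) ≠ 0 := by exact_mod_cast h0.ne'
  have h1 := tendsto_rayS_div (s := s) hb hν h0.ne'
  rw [abs_of_pos h0] at h1
  have hc : Continuous fun z : ℂ => 2 * Complex.I * b - b ^ 2 * z
    - (2 * s + s ^ 2 * z) * (1 - (ν : ℂ) ^ 2) := by fun_prop
  have h2 := ((hc.tendsto 0).comp tendsto_ofReal_inv_atTop).div (h1.add_const (ν : ℂ))
    (by rw [← two_mul]; exact mul_ne_zero two_ne_zero hν0)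
  have h3 := (h2.sub_const (s * ν : ℂ)).sub_const (Complex.I * b)
  refine (h3.congr' ?_).trans_eq ?_
  · filter_upwards [eventually_gt_atTop 0] with τ hτ
    have hτ0 : (τ : ℂ) ≠ 0 := by exact_mod_cast hτ.ne'
    have hsq := upRoot_sq (((τ : ℝ) + Complex.I * (b : ℝ)) ^ 2
      - (((τ + s) ^ 2 * (1 - ν ^ 2) : ℝ) : ℂ))
    change rayS b s ν τ ^ 2 = _ at hsq
    have hre : 0 < (rayS b s ν τ).re :=
      zero_lt_upRoot_re (by simpa using hb) (by simpa using hτ)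
        (mul_nonneg (sq_nonneg _) (by linarith))
    have hne : rayS b s ν τ + ν * τ ≠ 0 := by
      intro h
      have := congrArg Complex.re h
      simp at this
      nlinarith [mul_pos h0 hτ]
    simp only [Pi.div_apply, Function.comp_apply]
    have hden : rayS b s ν τ / τ + ν ≠ 0 := by
      intro h
      apply hne
      field_simp at h
      linear_combination h
    have key : (2 * Complex.I * b - b ^ 2 * ((τ⁻¹ : ℝ) : ℂ)
        - (2 * s + s ^ 2 * ((τ⁻¹ : ℝ) : ℂ)) * (1 - (ν : ℂ) ^ 2)) / (rayS b s ν τ / τ + ν) =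
        rayS b s ν τ - τ * ν := by
      rw [div_eq_iff hden]
      push_cast at hsq ⊢
      field_simp
      linear_combination (-1 : ℂ) * hsq - b ^ 2 * Complex.I_sq
    rw [key]
    push_cast
    ring
  · congr 1
    simp only [mul_zero, sub_zero, add_zero]
    field_simp
    ring

/-- Here S/τ tends to -ν while z/τ tends to ν, so the phase grows like -2ντ. With the decay of f
this yields the zero far field in backward directions. -/
lemma tendsto_norm_rayPhase_of_neg (hb : 0 < b) (hν : ν ^ 2 ≤ 1) (h0 : ν < 0) :
    Tendsto (fun τ : ℝ => ‖rayS b s ν τ - ((τ + s) * ν : ℝ) - Complex.I * b‖) atTop atTop := by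
  have h1 := tendsto_rayS_div (s := s) hb hν h0.ne
  rw [abs_of_neg h0] at h1
  have hc : Continuous fun z : ℂ => (1 + s * z) * ν + Complex.I * b * z := by fun_prop
  have h2 := (h1.sub ((hc.tendsto 0).comp tendsto_ofReal_inv_atTop)).norm
  have hlim : 0 < ‖((-ν : ℝ) : ℂ) - ((1 + s * 0) * ν + Complex.I * b * 0)‖ := by
    rw [norm_pos_iff]
    have hν0 : (ν : ℂ) ≠ 0 := by exact_mod_cast h0.ne
    push_cast
    simp only [mul_zero, add_zero, one_mul]
    rw [show -(ν : ℂ) - ν = (-2) * ν by ring]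
    exact mul_ne_zero (by norm_num) hν0
  refine (h2.pos_mul_atTop hlim tendsto_id).congr' ?_
  filter_upwards [eventually_gt_atTop 0] with τ hτ
  have hτ0 : (τ : ℂ) ≠ 0 := by exact_mod_cast hτ.ne'
  have e : ((id τ : ℝ)) = ‖(τ : ℂ)‖ := by
    rw [Complex.norm_real, Real.norm_of_nonneg hτ.le, id]
  rw [e, ← norm_mul]
  congr 1
  simp only [Function.comp_apply]
  push_cast
  field_simp
  ring

lemma IsWaveform.tendsto_farField_aux (hf : IsWaveform f) (hb : 0 < b) (hν : ν ^ 2 ≤ 1)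
    (h0 : ν ≠ 0) :
    Tendsto (fun τ : ℝ => (τ : ℂ) *
        (f (rayS b s ν τ - ((τ + s) * ν : ℝ) - Complex.I * b) / rayS b s ν τ)) atTop
      (𝓝 (heavisideStep ν / ν * f ((-(s : ℂ) + Complex.I * b * (1 - ν)) / ν))) := by
  have h1 := tendsto_rayS_div (s := s) hb hν h0
  have hν0 : ((|ν| : ℝ) : ℂ) ≠ 0 := by exact_mod_cast (abs_pos.mpr h0).ne'
  have hmem : ∀ τ : ℝ, rayS b s ν τ - ((τ + s) * ν : ℝ) - Complex.I * b ∈ closedUpperHalf := by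
    intro τ
    have h := im_le_upRoot_im (T := (τ : ℝ) + Complex.I * (b : ℝ)) (by simpa using hb)
      (r := (τ + s) ^ 2 * (1 - ν ^ 2)) (mul_nonneg (sq_nonneg _) (by linarith))
    have e : (rayS b s ν τ - ((τ + s) * ν : ℝ) - Complex.I * b).im = (rayS b s ν τ).im - b := by
      simp only [Complex.sub_im, Complex.ofReal_im, Complex.mul_im, Complex.I_re, Complex.I_im,
        Complex.ofReal_re]
      ring
    change 0 ≤ Complex.im _
    rw [e, rayS, sub_nonneg]
    simpa using h
  have hgoal : ∀ L : ℂ, Tendsto (fun τ : ℝ =>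
      f (rayS b s ν τ - ((τ + s) * ν : ℝ) - Complex.I * b)) atTop (𝓝 L) →
      Tendsto (fun τ : ℝ => (τ : ℂ) *
        (f (rayS b s ν τ - ((τ + s) * ν : ℝ) - Complex.I * b) / rayS b s ν τ)) atTop
      (𝓝 (L / (|ν| : ℝ))) := by
    intro L hL
    refine (hL.div h1 hν0).congr' ?_
    filter_upwards [eventually_gt_atTop 0] with τ hτ
    have hτ0 : (τ : ℂ) ≠ 0 := by exact_mod_cast hτ.ne'
    simp only [Pi.div_apply]
    rw [div_div_eq_mul_div, mul_div_assoc', mul_comm]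
  rcases lt_or_gt_of_ne h0 with hneg | hpos
  · have hz : Tendsto (fun τ : ℝ =>
        f (rayS b s ν τ - ((τ + s) * ν : ℝ) - Complex.I * b)) atTop (𝓝 0) := by
      have hn := tendsto_norm_rayPhase_of_neg (s := s) hb hν hneg
      have ht : Tendsto (fun τ : ℝ => rayS b s ν τ - ((τ + s) * ν : ℝ) - Complex.I * b) atTop
          (Bornology.cobounded ℂ ⊓ 𝓟 closedUpperHalf) :=
        tendsto_inf.mpr ⟨tendsto_norm_atTop_iff_cobounded.mp hn,
          tendsto_principal.mpr (Eventually.of_forall hmem)⟩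
      exact (hf.decay.comp_tendsto ht).trans_tendsto (tendsto_inv_atTop_zero.comp hn)
    have := hgoal 0 hz
    simpa [heavisideStep, not_lt.mpr hneg.le] using this
  · have hlim := tendsto_rayPhase_of_pos (s := s) hb hν hpos
    have hcl : IsClosed closedUpperHalf := isClosed_le continuous_const Complex.continuous_im
    have hL := hcl.mem_of_tendsto hlim (Eventually.of_forall hmem)
    have := hgoal _ (((hf.contDiffOn.continuousOn _ hL).tendsto).comp
      (tendsto_nhdsWithin_iff.mpr ⟨hlim, Eventually.of_forall hmem⟩))
    rw [heavisideStep, if_pos hpos]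
    rw [abs_of_pos hpos] at this
    convert this using 2
    ring

lemma IsWaveform.tendsto_farField (hf : IsWaveform f) {c : ℝ} (hc : 0 < c) (hb : 0 < b) (s : ℝ)
    (n : Metric.sphere (0 : Space3) 1) (hn : (n : Space3) 2 ≠ 0) :
    Tendsto (fun t : ℝ => ((c * t : ℝ) : ℂ) * quasiWave f c b t ((c * t + s) • (n : Space3)))
      atTop (𝓝 (farField f b s n)) := by
  have hnorm : (n : Space3) 0 ^ 2 + (n : Space3) 1 ^ 2 + (n : Space3) 2 ^ 2 = 1 := by
    have h := norm_eq_of_mem_sphere n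
    rw [EuclideanSpace.norm_eq, Real.sqrt_eq_one, Fin.sum_univ_three] at h
    simpa using h
  have hν : (n : Space3) 2 ^ 2 ≤ 1 := by nlinarith [sq_nonneg ((n : Space3) 0), sq_nonneg ((n : Space3) 1)]
  have h := (hf.tendsto_farField_aux (s := s) hb hν hn).comp (tendsto_id.const_mul_atTop hc)
  refine h.congr fun t => ?_
  have hr : rhoSq ((c * t + s) • (n : Space3)) = (c * t + s) ^ 2 * (1 - (n : Space3) 2 ^ 2) := by
    rw [rhoSq]
    simp only [PiLp.smul_apply, smul_eq_mul]
    linear_combination (c * t + s) ^ 2 * hnorm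
  have hS : quasiS c b t ((c * t + s) • (n : Space3)) = rayS b s ((n : Space3) 2) (c * t) := by
    rw [quasiS_eq_upRoot, hr, rayS]
  simp only [Function.comp_apply, quasiWave, quasiPhase, hS, PiLp.smul_apply, smul_eq_mul, id]

lemma uniqueDiffOn_closedUpperHalf : UniqueDiffOn ℂ closedUpperHalf := by
  refine uniqueDiffOn_convex_of_isRCLikeNormedField (convex_halfSpace_im_ge 0) ⟨Complex.I, ?_⟩
  rw [mem_interior]
  exact ⟨openUpperHalf, fun z (hz : 0 < z.im) => hz.le, isOpen_openUpperHalf, by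
    simp [openUpperHalf]⟩

/-- On half-discs, compactness bounds f and its derivative within the closed half-plane, which
agrees with `deriv` at interior points. Outside a large disc the decay in |θ| suffices, because Im θ
≤ |θ|. -/
lemma IsWaveform.isProfile (hf : IsWaveform f) : IsProfile f := by
  have hcl : IsClosed closedUpperHalf := isClosed_le continuous_const Complex.continuous_im
  have hsub : openUpperHalf ⊆ closedUpperHalf := fun z (hz : 0 < z.im) => hz.le
  have hnhds : ∀ θ ∈ openUpperHalf, closedUpperHalf ∈ 𝓝 θ := fun θ hθ =>
    mem_of_superset (isOpen_openUpperHalf.mem_nhds hθ) hsub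
  obtain ⟨hd, hc⟩ := (contDiffOn_one_iff_derivWithin uniqueDiffOn_closedUpperHalf).mp hf.contDiffOn
  have hcpt : ∀ r : ℝ, IsCompact (Metric.closedBall (0 : ℂ) r ∩ closedUpperHalf) := fun r =>
    (isCompact_closedBall 0 r).inter_right hcl
  refine ⟨hd.continuousOn, hd.mono hsub, ?_, fun r => ?_⟩
  · obtain ⟨C, hC⟩ := hf.decay.bound
    rw [eventually_inf_principal, (hasBasis_cobounded_norm).eventually_iff] at hC
    obtain ⟨r, -, hr⟩ := hC
    obtain ⟨M, hM⟩ := (hcpt r).exists_bound_of_continuousOn (hd.continuousOn.mono inter_subset_right)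
    refine ⟨|C| + |M| * |r|, fun θ hθ => ?_⟩
    have hθ0 : 0 < θ.im := hθ
    have hle : θ.im ≤ ‖θ‖ := (le_abs_self _).trans (Complex.abs_im_le_norm θ)
    rw [le_div_iff₀ hθ0]
    rcases le_total r ‖θ‖ with h | h
    · have h1 := hr (by exact h) (hsub hθ)
      rw [norm_inv, norm_norm] at h1
      calc ‖f θ‖ * θ.im ≤ (|C| * ‖θ‖⁻¹) * ‖θ‖ := by
            gcongr
            exact h1.trans (by gcongr; exact le_abs_self C)
        _ = |C| := by
            have : ‖θ‖ ≠ 0 := (hθ0.trans_le hle).ne'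
            field_simp
        _ ≤ _ := le_add_of_nonneg_right (by positivity)
    · have h1 := hM θ ⟨mem_closedBall_zero_iff.mpr h, hsub hθ⟩
      calc ‖f θ‖ * θ.im ≤ |M| * |r| := by
            gcongr
            · exact h1.trans (le_abs_self M)
            · exact hle.trans (h.trans (le_abs_self r))
        _ ≤ _ := le_add_of_nonneg_left (by positivity)
  · obtain ⟨M, hM⟩ := (hcpt r).exists_bound_of_continuousOn (hc.mono inter_subset_right)
    refine ⟨M, fun θ hθ h => ?_⟩
    rw [← derivWithin_of_mem_nhds (hnhds θ hθ)]
    exact hM θ ⟨mem_closedBall_zero_iff.mpr h, hsub hθ⟩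

end farfield

/-! ### Superposition of monochromatic plane waves -/

/-- The modulus is e^{-κ Im θ} ≤ 1 / (κ Im θ). There is no decay along horizontal lines, so this is
not a waveform and the weaker notion of profile is needed. -/
lemma isProfile_exp {κ : ℝ} (hκ : 0 < κ) : IsProfile fun θ => Complex.exp (Complex.I * κ * θ) := by
  have hn : ∀ θ : ℂ, ‖Complex.exp (Complex.I * κ * θ)‖ = Real.exp (-(κ * θ.im)) := by
    intro θ
    rw [Complex.norm_exp]
    congr 1
    simp
  have hd : Differentiable ℂ fun θ : ℂ => Complex.exp (Complex.I * κ * θ) := by fun_prop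
  refine ⟨hd.continuous.continuousOn, hd.differentiableOn, ⟨1 / κ, fun θ hθ => ?_⟩,
    fun r => ⟨κ, fun θ hθ _ => ?_⟩⟩
  · have hθ0 : 0 < θ.im := hθ
    have hpos : 0 < κ * θ.im := mul_pos hκ hθ0
    rw [hn, Real.exp_neg, div_div, ← one_div]
    gcongr
    linarith [Real.add_one_le_exp (κ * θ.im)]
  · have hθ0 : 0 < θ.im := hθ
    have h : deriv (fun θ : ℂ => Complex.exp (Complex.I * κ * θ)) θ =
        Complex.exp (Complex.I * κ * θ) * (Complex.I * κ) := by
      simpa using (((hasDerivAt_id θ).const_mul (Complex.I * (κ : ℂ))).cexp).deriv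
    rw [h, norm_mul, hn, norm_mul, Complex.norm_I, Complex.norm_real, Real.norm_of_nonneg hκ.le,
      one_mul]
    refine mul_le_of_le_one_left hκ.le (Real.exp_le_one_iff.mpr ?_)
    exact neg_nonpos.mpr (mul_pos hκ hθ0).le

section planeWave

variable {b : ℝ}

lemma measurable_planeWave (c b t : ℝ) (R : Space3) : Measurable (planeWave c b t R) := by
  unfold planeWave
  refine Measurable.div (Continuous.measurable ?_) (Continuous.measurable ?_) <;> fun_prop

/-- Scaling the transverse wave vector by κ gives k = κ w. The factor -i/κ² compensates the iκ from
differentiation and leaves 1/κ. -/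
lemma planeWave_smul (c b t : ℝ) (R : Space3) {κ : ℝ} (hκ : 0 < κ) (P : ℝ × ℝ) :
    planeWave c b t R !₂[κ * P.1, κ * P.2, κ] =
      (-(Complex.I / (κ : ℂ) ^ 2)) *
        (deriv (fun θ => Complex.exp (Complex.I * κ * θ))
          (shellPhase ((c * t : ℝ) + Complex.I * (b : ℝ)) (R 0) (R 1)
            ((R 2 : ℝ) + Complex.I * (b : ℝ)) P) / (shell P : ℝ)) := by
  have hκ0 : (κ : ℂ) ≠ 0 := by exact_mod_cast hκ.ne'
  have hs := shell_ne_zero P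
  have h : ∀ θ : ℂ, deriv (fun θ : ℂ => Complex.exp (Complex.I * κ * θ)) θ =
      Complex.exp (Complex.I * κ * θ) * (Complex.I * κ) := fun θ => by
    simpa using (((hasDerivAt_id θ).const_mul (Complex.I * (κ : ℂ))).cexp).deriv
  rw [h, planeWave, norm_smul_shell κ hκ P, shellPhase]
  simp only [Matrix.cons_val_zero, Matrix.cons_val_one, Matrix.cons_val]
  have e : Complex.I * (((κ * shell P : ℝ) : ℂ) * ((c * t : ℝ) + Complex.I * (b : ℝ))
      - (κ : ℂ) * ((R 2 : ℝ) + Complex.I * (b : ℝ)) - ((κ * P.1 : ℝ) : ℂ) * (R 0 : ℝ)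
      - ((κ * P.2 : ℝ) : ℂ) * (R 1 : ℝ)) =
      Complex.I * κ * (((c * t : ℝ) + Complex.I * (b : ℝ)) * (shell P : ℝ)
        - (R 0 : ℂ) * (P.1 : ℝ) - (R 1 : ℂ) * (P.2 : ℝ) - ((R 2 : ℝ) + Complex.I * (b : ℝ))) := by
    push_cast
    ring
  rw [e]
  push_cast
  field_simp
  rw [Complex.I_sq]
  ring

lemma integrable_planeWave_slice (hb : 0 < b) (c t : ℝ) (R : Space3) {κ : ℝ} (hκ : 0 < κ) :
    Integrable fun P : ℝ × ℝ => planeWave c b t R !₂[P.1, P.2, κ] := by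
  rw [← integrable_comp_smul_iff volume _ hκ.ne']
  simp only [Prod.smul_fst, Prod.smul_snd, smul_eq_mul, planeWave_smul c b t R hκ]
  exact ((isProfile_exp hκ).integrable_shell hb (waveT_im c b t).ge (by simp) _ _).const_mul _

/-- This is the shell identity for e^{iκθ}; the Jacobian κ² of the transverse scaling cancels the
κ⁻² of `planeWave_smul`. -/
lemma integral_planeWave_slice (hb : 0 < b) (c t : ℝ) (R : Space3) {κ : ℝ} (hκ : 0 < κ) :
    ∫ P : ℝ × ℝ, planeWave c b t R !₂[P.1, P.2, κ] =
      2 * Real.pi * Complex.I *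
        (Complex.exp (Complex.I * κ * quasiPhase c b t R) / quasiS c b t R) := by
  have hκ0 : (κ : ℂ) ≠ 0 := by exact_mod_cast hκ.ne'
  have h := Measure.integral_comp_smul volume
    (fun P : ℝ × ℝ => planeWave c b t R !₂[P.1, P.2, κ]) κ
  simp only [Prod.smul_fst, Prod.smul_snd, smul_eq_mul, planeWave_smul c b t R hκ] at h
  rw [integral_const_mul, (isProfile_exp hκ).integral_shell_eq_quasiWave hb] at h
  have hfr : Module.finrank ℝ (ℝ × ℝ) = 2 := by simp
  rw [hfr, abs_of_pos (by positivity), Complex.real_smul] at h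
  have h2 := congrArg (fun z : ℂ => (κ : ℂ) ^ 2 * z) h
  simp only [quasiWave] at h2
  push_cast at h2
  rw [mul_inv_cancel_left₀ (pow_ne_zero 2 hκ0)] at h2
  rw [← h2]
  field_simp

/-- Real t and R affect only the oscillating phase, so absolute integrals are themselves plane-wave
integrals that can be evaluated exactly. -/
lemma norm_planeWave (c b t : ℝ) (R K : Space3) :
    ((‖planeWave c b t R K‖ : ℝ) : ℂ) = planeWave c b 0 0 K := by
  rw [planeWave, norm_div, Complex.norm_exp, Complex.norm_real, norm_norm, planeWave]
  push_cast
  congr 2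
  apply Complex.ext <;> simp

/-- At t = 0, R = 0 one has S = ib and θ = 0. The value does not depend on κ, so integrability of
the spectrum alone controls the triple integral. -/
lemma integral_norm_planeWave_slice (hb : 0 < b) (c t : ℝ) (R : Space3) {κ : ℝ} (hκ : 0 < κ) :
    ∫ P : ℝ × ℝ, ‖planeWave c b t R !₂[P.1, P.2, κ]‖ = 2 * Real.pi / b := by
  have h := integral_planeWave_slice hb c 0 0 hκ
  simp_rw [← norm_planeWave c b t R] at h
  rw [integral_complex_ofReal, quasiPhase, quasiS_axis c b 0 hb 0 (by simp [rhoSq])] at h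
  have hb0 : (b : ℂ) ≠ 0 := by exact_mod_cast hb.ne'
  have h2 : ((∫ P : ℝ × ℝ, ‖planeWave c b t R !₂[P.1, P.2, κ]‖ : ℝ) : ℂ) =
      ((2 * Real.pi / b : ℝ) : ℂ) := by
    rw [h]
    push_cast
    simp
    field_simp
    simp
  exact_mod_cast h2

lemma heavisideStep_mul_eq_indicator (g : ℝ → ℂ) (k : ℝ) :
    heavisideStep k * g k = (Ioi (0 : ℝ)).indicator g k := by
  simp [heavisideStep, indicator_apply]

/-- The spectral density of the superposition of plane waves, in coordinates `(k_z, (k_x, k_y))`. -/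
lemma integrable_spectral (hb : 0 < b) (c t : ℝ) (R : Space3) {g : ℝ → ℂ}
    (hg : IntegrableOn g (Ioi 0)) :
    Integrable fun z : ℝ × (ℝ × ℝ) =>
      (Ioi (0 : ℝ)).indicator g z.1 * planeWave c b t R !₂[z.2.1, z.2.2, z.1] := by
  have hg' : Integrable ((Ioi (0 : ℝ)).indicator g) :=
    (integrable_indicator_iff measurableSet_Ioi).mpr hg
  have hmeas : AEStronglyMeasurable (fun z : ℝ × (ℝ × ℝ) =>
      (Ioi (0 : ℝ)).indicator g z.1 * planeWave c b t R !₂[z.2.1, z.2.2, z.1])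
      ((volume : Measure ℝ).prod (volume : Measure (ℝ × ℝ))) := by
    refine AEStronglyMeasurable.mul (hg'.aestronglyMeasurable.comp_fst) ?_
    have e : (fun z : ℝ × (ℝ × ℝ) => planeWave c b t R !₂[z.2.1, z.2.2, z.1]) =
        planeWave c b t R ∘ axialCoords.symm :=
      funext fun z => congrArg _ (axialCoords_symm_apply z.1 z.2.1 z.2.2).symm
    rw [e]
    exact ((measurable_planeWave c b t R).comp axialCoords.symm.measurable).aestronglyMeasurable
  rw [Measure.volume_eq_prod, integrable_prod_iff hmeas]
  constructor
  · refine Eventually.of_forall fun k => ?_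
    by_cases hk : 0 < k
    · exact (integrable_planeWave_slice hb c t R hk).const_mul ((Ioi (0 : ℝ)).indicator g k)
    · simp [hk]
  · refine (hg'.norm.mul_const (2 * Real.pi / b)).congr (Eventually.of_forall fun k => ?_)
    by_cases hk : 0 < k
    · simp only [norm_mul]
      rw [integral_const_mul, integral_norm_planeWave_slice hb c t R hk]
    · simp [hk]

lemma spectral_comp_axialCoords (c b t : ℝ) (R : Space3) (g : ℝ → ℂ) (K : Space3) :
    heavisideStep (K 2) * g (K 2) * planeWave c b t R K =
      (fun z : ℝ × (ℝ × ℝ) =>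
        (Ioi (0 : ℝ)).indicator g z.1 * planeWave c b t R !₂[z.2.1, z.2.2, z.1])
      (axialCoords K) := by
  have : !₂[K 0, K 1, K 2] = K := by
    rw [← axialCoords_symm_apply, ← axialCoords_apply, MeasurableEquiv.symm_apply_apply]
  rw [heavisideStep_mul_eq_indicator, axialCoords_apply]
  simp only [this]

lemma integrable_superposition (hb : 0 < b) (c t : ℝ) (R : Space3) {g : ℝ → ℂ}
    (hg : IntegrableOn g (Ioi 0)) :
    Integrable fun K : Space3 => heavisideStep (K 2) * g (K 2) * planeWave c b t R K := by
  simp_rw [spectral_comp_axialCoords]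
  exact (measurePreserving_axialCoords.integrable_comp_emb
    axialCoords.measurableEmbedding).mpr (integrable_spectral hb c t R hg)

lemma integral_superposition (hb : 0 < b) (c t : ℝ) (R : Space3) {g : ℝ → ℂ}
    (hg : IntegrableOn g (Ioi 0)) :
    ∫ K : Space3, heavisideStep (K 2) * g (K 2) * planeWave c b t R K =
      ∫ kz in Ioi (0 : ℝ), g kz * ∫ P : ℝ × ℝ, planeWave c b t R !₂[P.1, P.2, kz] := by
  simp_rw [spectral_comp_axialCoords]
  refine (measurePreserving_axialCoords.integral_comp axialCoords.measurableEmbedding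
    (fun z : ℝ × (ℝ × ℝ) => (Ioi (0 : ℝ)).indicator g z.1 *
      planeWave c b t R !₂[z.2.1, z.2.2, z.1])).trans ?_
  have h := integrable_spectral hb c t R hg
  rw [Measure.volume_eq_prod] at h ⊢
  rw [integral_prod _ h, ← integral_indicator measurableSet_Ioi]
  refine integral_congr_ae (Eventually.of_forall fun k => ?_)
  simp only [integral_const_mul]
  by_cases hk : 0 < k <;> simp [hk]

lemma integral_spectrum (hb : 0 < b) (c t : ℝ) (R : Space3) {f : ℂ → ℂ} {g : ℝ → ℂ}
    (hf : ∀ θ ∈ closedUpperHalf,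
      f θ = ∫ κ in Ioi (0 : ℝ), g κ * Complex.exp (Complex.I * (κ : ℝ) * θ)) :
    ∫ kz in Ioi (0 : ℝ), g kz * ∫ P : ℝ × ℝ, planeWave c b t R !₂[P.1, P.2, kz] =
      2 * Real.pi * Complex.I * quasiWave f c b t R := by
  rw [quasiWave, hf _ (quasiPhase_mem c b t hb R), div_eq_mul_inv, ← integral_mul_const,
    ← integral_const_mul]
  refine setIntegral_congr_fun measurableSet_Ioi fun k hk => ?_
  rw [integral_planeWave_slice hb c t R hk]
  ring

end planeWave

/-! ### Assembly of the representations -/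

theorem mainTheorem2 (c b : ℝ) (hc : 0 < c) (hb : 0 < b) :
    -- superposition of non-stationary plane waves over the forward hemisphere
    (∀ f : ℂ → ℂ, IsWaveform f →
      -- the far-field limit, in every direction not orthogonal to the `z` axis
      (∀ (s : ℝ) (n : Metric.sphere (0 : Space3) 1), (n : Space3) 2 ≠ 0 →
        Tendsto (fun t : ℝ => ((c * t : ℝ) : ℂ) * quasiWave f c b t ((c * t + s) • (n : Space3)))
          atTop (𝓝 (farField f b s n))) ∧
      ∀ (t : ℝ) (R : Space3),
        -- the wave recovered from its far field by integration over the whole sphere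
        Integrable (fun N : Metric.sphere (0 : Space3) 1 =>
          deriv (fun s : ℝ => farField f b s N) (inner ℝ (N : Space3) R - c * t))
          surfaceMeasure ∧
        quasiWave f c b t R = 1 / (2 * (Real.pi : ℂ)) *
          ∫ N : Metric.sphere (0 : Space3) 1,
            deriv (fun s : ℝ => farField f b s N) (inner ℝ (N : Space3) R - c * t)
            ∂surfaceMeasure ∧
        -- the integral over the forward hemisphere
        IntegrableOn (fun N : Metric.sphere (0 : Space3) 1 =>
          1 / ((((N : Space3) 2 : ℝ) : ℂ)) ^ 2 *
            deriv f ((((c * t - inner ℝ (N : Space3) R : ℝ) : ℂ)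
              + Complex.I * (b : ℝ) * (1 - ((N : Space3) 2 : ℝ))) / ((N : Space3) 2 : ℝ)))
          {N | 0 < (N : Space3) 2} surfaceMeasure ∧
        quasiWave f c b t R = -(1 / (2 * (Real.pi : ℂ))) *
          ∫ N : Metric.sphere (0 : Space3) 1 in {N | 0 < (N : Space3) 2},
            1 / ((((N : Space3) 2 : ℝ) : ℂ)) ^ 2 *
              deriv f ((((c * t - inner ℝ (N : Space3) R : ℝ) : ℂ)
                + Complex.I * (b : ℝ) * (1 - ((N : Space3) 2 : ℝ))) / ((N : Space3) 2 : ℝ))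
            ∂surfaceMeasure ∧
        -- the same integral in spherical coordinates
        quasiWave f c b t R = -(1 / (2 * (Real.pi : ℂ))) *
          ∫ φ in (-Real.pi)..Real.pi, ∫ χ in (0 : ℝ)..(Real.pi / 2),
            ((Real.sin χ / Real.cos χ ^ 2 : ℝ) : ℂ) *
              deriv f ((((c * t : ℝ) + Complex.I * (b : ℝ))
                - ((R 2 : ℝ) + Complex.I * (b : ℝ)) * (Real.cos χ : ℝ)
                - (((R 0 * Real.cos φ + R 1 * Real.sin φ) * Real.sin χ : ℝ) : ℂ))
                / (Real.cos χ : ℝ))) ∧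
    -- superposition of monochromatic plane waves
    (∀ (f : ℂ → ℂ) (fhat : ℝ → ℂ), IntegrableOn fhat (Ioi 0) →
      (∀ θ ∈ closedUpperHalf,
        f θ = ∫ κ in Ioi (0 : ℝ), fhat κ * Complex.exp (Complex.I * (κ : ℝ) * θ)) →
      ∀ (t : ℝ) (R : Space3),
        quasiWave f c b t R = -(Complex.I / (2 * (Real.pi : ℂ))) *
          ∫ kz in Ioi (0 : ℝ), fhat kz * ∫ kx : ℝ, ∫ ky : ℝ, planeWave c b t R !₂[kx, ky, kz] ∧
        Integrable (fun K : Space3 => heavisideStep (K 2) * fhat (K 2) * planeWave c b t R K) ∧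
        quasiWave f c b t R = -(Complex.I / (2 * (Real.pi : ℂ))) *
          ∫ K : Space3, heavisideStep (K 2) * fhat (K 2) * planeWave c b t R K) := by

  refine ⟨fun f hf => ⟨fun s n hn => hf.tendsto_farField hc hb s n hn, fun t R => ?_⟩,
    fun f fhat hfhat hf t R => ?_⟩
  · have hp := hf.isProfile
    have h := hp.integral_shell_eq_quasiWave hb c t R
    have hfwd : quasiWave f c b t R = -(1 / (2 * (Real.pi : ℂ))) *
        ∫ N in {N | 0 < (N : Space3) 2}, forwardIntegrand f c b t R N ∂surfaceMeasure := by
      rw [integral_forward]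
      exact eq_neg_one_div_mul_of_integral h
    refine ⟨hp.integrable_deriv_farField hb c t R, ?_, hp.integrableOn_forward hb c t R, hfwd, ?_⟩
    · rw [hp.integral_deriv_farField hb, mul_neg, ← neg_mul]
      exact hfwd
    · rw [hp.integral_shell_spherical hb (waveT_im c b t).ge (by simp)] at h
      exact eq_neg_one_div_mul_of_integral h
  · have hpi : (Real.pi : ℂ) ≠ 0 := by exact_mod_cast Real.pi_ne_zero
    have hu : quasiWave f c b t R = -(Complex.I / (2 * (Real.pi : ℂ))) *
        ∫ kz in Ioi (0 : ℝ), fhat kz * ∫ P : ℝ × ℝ, planeWave c b t R !₂[P.1, P.2, kz] := by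
      rw [integral_spectrum hb c t R hf]
      field_simp
      rw [Complex.I_sq]
      ring
    refine ⟨?_, integrable_superposition hb c t R hfhat, ?_⟩
    · rw [hu]
      congr 1
      refine setIntegral_congr_fun measurableSet_Ioi fun k hk => ?_
      have hi := integrable_planeWave_slice hb c t R hk
      rw [Measure.volume_eq_prod] at hi
      rw [Measure.volume_eq_prod, integral_prod _ hi]
    · rw [integral_superposition hb c t R hfhat, hu]
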